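/- Graphs are finite; loops and repeated edges are allowed. Each edge of a graph $X$ gives two mutually inverse arcs $e$ and $\bar e$ (its two directions of travel; also for a loop), with origin $o(e)$ and terminus $t(e)$. Degrees and the entries of the adjacency matrix count arcs, so a loop counts twice. Call $X$ md2 if all its vertices have degree at least $2$. A cycle is a sequence $c=(e_1,\dots,e_n)$ of $n\ge 1$ arcs with $t(e_i)=o(e_{i+1})$ for $1\le i<n$ and $t(e_n)=o(e_1)$; it has backtracking if $e_i=\overline{e_{i+1}}$ for some $1\le i<n$, has a tail if $e_1=\overline{e_n}$, and is primitive if it is not obtained by going $r\ge 2$ times around some cycle. A prime cycle $[c]$ is the class, up to cyclic permutation, of a primitive cycle without backtracking or tail. The edge zeta function of $X$, in one complex variable $u_e$ for each arc $e$ of $X$, is $$\zeta_X(\vec u)=\prod_{[c]\text{ prime cycle}}\Bigl(1-\prod_{e\text{ in }c}u_e\Bigr)^{-1}\qquad(\vec u\text{ near }0),$$ where arcs are counted with multiplicity. A graph $W$ is determined by its adjacency spectrum if every graph with the same adjacency eigenvalues, with multiplicities, is isomorphic to $W$; if $W$ is simple, this is only required of simple graphs. For a set $S$ of vertices of $X$,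 the vertex-induced subgraph $\langle S\rangle$ has vertex set $S$ and all edges of $X$ with both ends in $S$. For a set $R$ of edges of $X$, the edge-induced subgraph $\langle R\rangle$ has edge set $R$ and, as vertices, those incident to some edge in $R$. Let $s_v(W,X)$ and $s_e(W,X)$ be the numbers of vertex-induced and of edge-induced subgraphs of $X$ that are isomorphic to $W$. **Theorem 3.5 (Counting subgraphs).** Let $W$ be a $k$-regular graph that is determined by its adjacency spectrum. Then, for md2 graphs $X$, the edge zeta function $\zeta_X$, given together with the pairing of the variables of inverse arcs, determines both $s_v(W,X)$ and $s_e(W,X)$. That is, if $X$ and $Y$ are md2 graphs and $\sigma$ is a bijection from the arcs of $X$ to the arcs of $Y$ with $\sigma(\bar e)=\overline{\sigma(e)}$ for all $e$, such that $\zeta_X\bigl((u_{\sigma(e)})_e\bigr)=\zeta_Y(\vec u)$ for all $\vec u$ near $0$, then $s_v(W,X)=s_v(W,Y)$ and $s_e(W,X)=s_e(W,Y)$. -/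

import Mathlib

/-!
Graphs here are the finite multigraphs of Mathlib (`Graph α β`): loops and repeated edges are
allowed. A graph is finite when its sets of vertices and of edges are finite.
-/

open scoped Graph

namespace Graph

variable {α β γ δ : Type*}

/-- An arc of the symmetric digraph `D(G)`: an edge of `G` with a direction of travel.
An edge between two distinct vertices `x`, `y` gives the two arcs `(x, y)` and `(y, x)`
(both with `side = false`). A loop at `x` also gives two arcs, both from `x` to `x`; they are told
apart by `side`. So `D(G)` has exactly twice as many arcs as `G` has edges. -/
@[ext]
structure Arc (G : Graph α β) where
  edge : β
  src : α
  tgt : α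
  side : Bool
  isLink : G.IsLink edge src tgt
  side_eq : src ≠ tgt → side = false

namespace Arc

variable {G : Graph α β}

open Classical in
/-- The inverse arc: the same edge, travelled in the opposite direction. -/
noncomputable def rev (a : G.Arc) : G.Arc where
  edge := a.edge
  src := a.tgt
  tgt := a.src
  side := if a.src = a.tgt then !a.side else a.side
  isLink := a.isLink.symm
  side_eq h := by
    rw [if_neg (Ne.symm h)]
    exact a.side_eq (Ne.symm h)

theorem rev_rev (a : G.Arc) : a.rev.rev = a := by
  by_cases h : a.src = a.tgt
  · ext <;> simp [rev, h]
  · ext <;> simp [rev, h, Ne.symm h]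

theorem rev_ne (a : G.Arc) : a.rev ≠ a := by
  intro h
  have h1 : a.tgt = a.src := congrArg Arc.src h
  have h2 : a.rev.side = a.side := congrArg Arc.side h
  simp [rev, h1] at h2

end Arc

/-! ### Cycles, prime cycles and the edge zeta function -/

/-- A cycle of length `n ≥ 1`: a sequence of arcs `e₁, …, eₙ` such that `eᵢ` ends where `eᵢ₊₁`
starts, and `eₙ` ends where `e₁` starts. Vertices, edges and arcs may be repeated. -/
def IsCycle (G : Graph α β) (c : List G.Arc) : Prop :=
  c ≠ [] ∧ c.IsChain (fun a b => a.tgt = b.src) ∧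
    ∀ a ∈ c.getLast?, ∀ b ∈ c.head?, a.tgt = b.src

/-- Two consecutive arcs are inverse to each other. -/
def HasBacktracking (G : Graph α β) (c : List G.Arc) : Prop :=
  ¬ c.IsChain (fun a b => a ≠ b.rev)

/-- The first arc is the inverse of the last one. -/
def HasTail (G : Graph α β) (c : List G.Arc) : Prop :=
  ∃ a ∈ c.head?, ∃ b ∈ c.getLast?, a = b.rev

/-- `c` is not obtained by going `r ≥ 2` times around a cycle `b`. -/
def IsPrimitive (G : Graph α β) (c : List G.Arc) : Prop :=
  ¬ ∃ (b : List G.Arc) (r : ℕ), G.IsCycle b ∧ 2 ≤ r ∧ c = (List.replicate r b).flatten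

/-- A prime cycle: the class, up to cyclic permutation, of a primitive cycle without backtracking
or tail. (`Cycle A` is Mathlib's type of lists in `A` up to cyclic permutation.) -/
def PrimeCycle (G : Graph α β) : Type _ :=
  {p : Cycle G.Arc // ∃ c : List G.Arc, (c : Cycle G.Arc) = p ∧
    G.IsCycle c ∧ ¬ G.HasBacktracking c ∧ ¬ G.HasTail c ∧ G.IsPrimitive c}

/-- `g(c)`, the product of the values `u e` over the arcs `e` of `c`, with multiplicity. -/
def PrimeCycle.weight {G : Graph α β} (p : G.PrimeCycle) (u : G.Arc → ℂ) : ℂ :=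
  (p.1.toMultiset.map u).prod

/-- The edge zeta function: the product of `(1 - g(c))⁻¹` over all prime cycles. For a finite graph
the product converges absolutely for `u` near `0`, and only its values there are used. -/
noncomputable def edgeZeta (G : Graph α β) (u : G.Arc → ℂ) : ℂ :=
  ∏' p : G.PrimeCycle, (1 - p.weight u)⁻¹

/-! ### Degrees and the adjacency spectrum -/

/-- The degree of a vertex: the number of arcs that start at it (a loop counts twice). -/
noncomputable def degree (G : Graph α β) (x : α) : ℕ :=
  {a : G.Arc | a.src = x}.ncard

/-- Every vertex has degree at least 2. -/
def MD2 (G : Graph α β) : Prop := ∀ x ∈ V(G), 2 ≤ G.degree x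

/-- Every vertex has degree `k`. -/
def IsRegular (G : Graph α β) (k : ℕ) : Prop := ∀ x ∈ V(G), G.degree x = k

/-- The adjacency matrix: the entry at `x, y` is the number of arcs from `x` to `y`, so the number
of edges between `x` and `y` if `x ≠ y`, and twice the number of loops at `x` if `x = y`. -/
noncomputable def adjacencyMatrix (G : Graph α β) : Matrix V(G) V(G) ℂ :=
  Matrix.of fun x y => ({a : G.Arc | a.src = x ∧ a.tgt = y}.ncard : ℂ)

open Classical in
/-- The eigenvalues of the adjacency matrix, with multiplicity. -/
noncomputable def adjacencySpectrum (G : Graph α β) [Finite V(G)] : Multiset ℂ :=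
  letI : Fintype V(G) := Fintype.ofFinite _
  G.adjacencyMatrix.charpoly.roots

/-! ### Isomorphisms and induced subgraphs -/

/-- An isomorphism of graphs: bijections of vertices and of edges that preserve incidence. -/
structure Iso (G : Graph α β) (H : Graph γ δ) where
  onVertices : V(G) ≃ V(H)
  onEdges : E(G) ≃ E(H)
  isLink_iff : ∀ (e : E(G)) (x y : V(G)),
    H.IsLink (onEdges e : δ) (onVertices x : γ) (onVertices y : γ) ↔ G.IsLink (e : β) (x : α) (y : α)

/-- Determined by the adjacency spectrum: every finite graph with the same spectrum is isomorphic
to `W`. As usual, a simple graph is only compared with simple graphs; a graph that is not simple is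
compared with all graphs. Every finite graph is isomorphic to one with vertices and edges in `ℕ`, so
it is enough to let `H` range over those. -/
def IsDeterminedBySpectrum (W : Graph α β) [Finite V(W)] : Prop :=
  ∀ (H : Graph ℕ ℕ) [Finite V(H)] [Finite E(H)],
    (W.Simple → H.Simple) → H.adjacencySpectrum = W.adjacencySpectrum → Nonempty (Iso W H)

/-- The edge-induced subgraph `⟨R⟩`: its edges are those in `R`, its vertices are the vertices
incident to some edge in `R`. (The vertex-induced subgraph `⟨S⟩` is Mathlib's `G.induce S`.) -/
def edgeInduce (G : Graph α β) (R : Set β) : Graph α β where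
  vertexSet := {x | ∃ e ∈ R, G.Inc e x}
  IsLink e x y := e ∈ R ∧ G.IsLink e x y
  isLink_symm _ _ := { symm _ _ h := ⟨h.1, h.2.symm⟩ }
  eq_or_eq_of_isLink_of_isLink _ _ _ _ _ h h' := h.2.left_eq_or_eq h'.2
  left_mem_of_isLink e _ _ h := ⟨e, h.1, h.2.inc_left⟩

/-- `s_v(W, X)`: the number of vertex-induced subgraphs of `X` isomorphic to `W`. -/
noncomputable def vertexInducedCount (W : Graph γ δ) (X : Graph α β) : ℕ :=
  {S : Set α | S ⊆ V(X) ∧ Nonempty (Iso (X.induce S) W)}.ncard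

/-- `s_e(W, X)`: the number of edge-induced subgraphs of `X` isomorphic to `W`. -/
noncomputable def edgeInducedCount (W : Graph γ δ) (X : Graph α β) : ℕ :=
  {R : Set β | R ⊆ E(X) ∧ Nonempty (Iso (X.edgeInduce R) W)}.ncard

end Graph

/-! The zeta function of an md2 graph, together with the pairing of inverse arcs, determines the
graph up to isomorphism; an isomorphism preserves both subgraph counts.

From zeta to degrees: taking logarithms in the Euler product and grouping closed non-backtracking
walks by their primitive root gives `1 / det (1 - M)` near `0`, with `M` the weighted
non-backtracking matrix (`Graph.eventually_edgeZeta_eq`). Put `u = t` on the arcs over a set `R` of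
edges and `u = 0` elsewhere: this yields `det (1 - t N)` for the non-backtracking matrix `N` of `R`,
hence `det N`. Permuting the rows of `N` by arc reversal gives `P Pᵀ - 1`, where `P` records
origins, so by Sylvester's identity `det N` is, up to a sign that the arc bijection respects, the
product of `1 - deg_R v` over all vertices. So this `defect` is known for every `R`
(`Graph.defect_eq_of_edgeZeta_eq`).

From degrees to the graph: an md2 graph is a subdivision of a reduced one, whose vertices have
degree at least `3` or carry just a loop (`exists_endsIso_sub_reduced`). A set has nonzero defect
exactly when no vertex has degree `1` in it; such sets never cut a subdivided edge, yet they
separate distinct edges of the reduced graph. This recovers the reduced edges with their lengths,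
and the defects of the reduced graph (`IsReducedEnds.endsIso_sub`). There, small sets of nonzero
defect detect loops, parallel edges and triangles, and products of defects detect whether two edges
share an end (`defect_mul_eq_iff`). As in Whitney's theorem on line graphs, adjacency of edges plus
this extra data recovers the stars of the vertices, hence the graph (`SameShape.exists_same_star`,
`SameShape.exists_equiv`). -/

namespace List

/-! ### Words up to rotation: periods, primitive roots, cyclic chains. -/

variable {A : Type*}

/-- The least positive number of rotations that fixes a nonempty list. -/
noncomputable def rotPeriod (c : List A) : ℕ :=
  Function.minimalPeriod (fun l : List A => l.rotate 1) c

theorem iterate_rotate_one (c : List A) (n : ℕ) :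
    (fun l : List A => l.rotate 1)^[n] c = c.rotate n := by
  induction n with
  | zero => simp
  | succ n ih => rw [Function.iterate_succ_apply', ih, rotate_rotate]

theorem isPeriodicPt_rotate_iff {c : List A} {n : ℕ} :
    Function.IsPeriodicPt (fun l : List A => l.rotate 1) n c ↔ c.rotate n = c := by
  rw [Function.IsPeriodicPt, Function.IsFixedPt, iterate_rotate_one]

theorem rotate_eq_self_iff_rotPeriod_dvd {c : List A} {n : ℕ} :
    c.rotate n = c ↔ c.rotPeriod ∣ n := by
  rw [← isPeriodicPt_rotate_iff, Function.isPeriodicPt_iff_minimalPeriod_dvd, rotPeriod]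

theorem rotPeriod_dvd_length (c : List A) : c.rotPeriod ∣ c.length :=
  rotate_eq_self_iff_rotPeriod_dvd.1 (rotate_length c)

theorem rotPeriod_pos {c : List A} (hc : c ≠ []) : 0 < c.rotPeriod :=
  Nat.pos_of_dvd_of_pos c.rotPeriod_dvd_length (length_pos_iff.2 hc)

theorem length_flatten_replicate (r : ℕ) (b : List A) :
    (replicate r b).flatten.length = r * b.length := by
  simp

theorem append_flatten_replicate_append (x y : List A) (r : ℕ) :
    x ++ (replicate r (y ++ x)).flatten = (replicate r (x ++ y)).flatten ++ x := by
  induction r with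
  | zero => simp
  | succ r ih =>
    rw [replicate_succ, replicate_succ, flatten_cons, flatten_cons, append_assoc, append_assoc,
      append_assoc, ih]

theorem rotate_one_flatten_replicate (b : List A) (r : ℕ) :
    (replicate r b).flatten.rotate 1 = (replicate r (b.rotate 1)).flatten := by
  rcases b with _ | ⟨a, l⟩
  · simp
  · rcases r with _ | r
    · simp
    · have h := append_flatten_replicate_append l [a] r
      rw [replicate_succ, flatten_cons, cons_append, rotate_cons_succ, rotate_zero,
        rotate_cons_succ, rotate_zero, replicate_succ', flatten_append]
      simp only [flatten_cons, flatten_nil, append_nil]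
      rw [← append_assoc, ← h]
      rfl

theorem rotate_flatten_replicate (b : List A) (r n : ℕ) :
    (replicate r b).flatten.rotate n = (replicate r (b.rotate n)).flatten := by
  induction n with
  | zero => simp
  | succ n ih => rw [← rotate_rotate, ih, rotate_one_flatten_replicate, rotate_rotate]

theorem flatten_replicate_injective {b b' : List A} {r : ℕ} (hr : r ≠ 0)
    (hl : b.length = b'.length) (h : (replicate r b).flatten = (replicate r b').flatten) :
    b = b' := by
  obtain ⟨r, rfl⟩ := Nat.exists_eq_succ_of_ne_zero hr
  rw [replicate_succ, replicate_succ, flatten_cons, flatten_cons] at h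
  exact (append_inj h hl).1

/-- Rotating a power is the same as taking the power of the rotated word, and a nonzero power
determines its base among words of a given length; so both words are fixed by the same rotations. -/
theorem rotPeriod_flatten_replicate (b : List A) {r : ℕ} (hr : r ≠ 0) :
    (replicate r b).flatten.rotPeriod = b.rotPeriod := by
  refine Nat.dvd_antisymm ?_ ?_
  · rw [← rotate_eq_self_iff_rotPeriod_dvd, rotate_flatten_replicate,
      rotate_eq_self_iff_rotPeriod_dvd.2 dvd_rfl]
  · rw [← rotate_eq_self_iff_rotPeriod_dvd]
    refine flatten_replicate_injective hr (by simp) ?_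
    rw [← rotate_flatten_replicate, rotate_eq_self_iff_rotPeriod_dvd.2 dvd_rfl]

/-- By commutation `b` is a prefix of `c ++ b`, hence of `c` once `c` is long enough; strip it off
and induct on `k`. -/
theorem eq_flatten_replicate_of_append_comm (b : List A) :
    ∀ (k : ℕ) (c : List A), c.length = k * b.length → b ++ c = c ++ b →
      c = (replicate k b).flatten
  | 0, c, hl, _ => by
    rw [zero_mul] at hl
    simpa using hl
  | k + 1, c, hl, h => by
    have hp : b <+: c := by
      refine prefix_of_prefix_length_le (l₃ := c ++ b) ?_ ⟨b, rfl⟩ (by rw [hl]; nlinarith)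
      exact ⟨c, h⟩
    obtain ⟨d, rfl⟩ := hp
    rw [append_assoc, append_cancel_left_eq] at h
    rw [replicate_succ, flatten_cons,
      ← eq_flatten_replicate_of_append_comm b k d (by simp at hl; nlinarith) h]

/-- The primitive root of a list. -/
noncomputable def rotRoot (c : List A) : List A := c.take c.rotPeriod

theorem length_rotRoot {c : List A} (hc : c ≠ []) : c.rotRoot.length = c.rotPeriod := by
  rw [rotRoot, length_take, min_eq_left]
  exact Nat.le_of_dvd (length_pos_iff.2 hc) c.rotPeriod_dvd_length

/-- Invariance under rotation by the period says that the initial segment of that length commutes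
with `c`, so `c` is a power of it. -/
theorem flatten_replicate_rotRoot (c : List A) :
    (replicate (c.length / c.rotPeriod) c.rotRoot).flatten = c := by
  rcases eq_or_ne c [] with rfl | hc
  · simp
  have hpos := rotPeriod_pos hc
  have hle := Nat.le_of_dvd (length_pos_iff.2 hc) c.rotPeriod_dvd_length
  obtain ⟨k, hk⟩ := c.rotPeriod_dvd_length
  symm
  have h1 : c.rotate c.rotPeriod = c := rotate_eq_self_iff_rotPeriod_dvd.2 dvd_rfl
  rw [rotate_eq_drop_append_take hle] at h1
  apply eq_flatten_replicate_of_append_comm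
  · rw [length_rotRoot hc, Nat.div_mul_cancel c.rotPeriod_dvd_length]
  · rw [rotRoot]
    calc take c.rotPeriod c ++ c
        = take c.rotPeriod c ++ (drop c.rotPeriod c ++ take c.rotPeriod c) := by rw [h1]
      _ = c ++ take c.rotPeriod c := by rw [← append_assoc, take_append_drop]

/-- A list is primitive if it is not a proper power. -/
def IsAperiodic (c : List A) : Prop := c ≠ [] ∧ c.rotPeriod = c.length

theorem isAperiodic_iff {c : List A} (hc : c ≠ []) :
    c.IsAperiodic ↔ ¬ ∃ (b : List A) (r : ℕ), 2 ≤ r ∧ c = (replicate r b).flatten := by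
  constructor
  · rintro ⟨-, h⟩ ⟨b, r, hr, rfl⟩
    have hb : b ≠ [] := by rintro rfl; simp at hc
    rw [rotPeriod_flatten_replicate b (by omega), length_flatten_replicate] at h
    have := Nat.le_of_dvd (length_pos_iff.2 hb) b.rotPeriod_dvd_length
    have := length_pos_iff.2 hb
    nlinarith
  · intro h
    refine ⟨hc, ?_⟩
    by_contra hne
    refine h ⟨c.rotRoot, c.length / c.rotPeriod, ?_, (flatten_replicate_rotRoot c).symm⟩
    obtain ⟨k, hk⟩ := c.rotPeriod_dvd_length
    have hpos := rotPeriod_pos hc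
    rw [hk, Nat.mul_div_cancel_left _ hpos]
    have : c.length ≠ 0 := by simpa using hc
    rcases k with _ | _ | k
    · omega
    · omega
    · omega

theorem isAperiodic_rotRoot {c : List A} (hc : c ≠ []) : c.rotRoot.IsAperiodic := by
  have hpos := rotPeriod_pos hc
  have hne : c.rotRoot ≠ [] := by
    rw [← length_pos_iff, length_rotRoot hc]; exact hpos
  refine ⟨hne, ?_⟩
  have h := rotPeriod_flatten_replicate c.rotRoot (r := c.length / c.rotPeriod) (by
    have := Nat.div_pos (Nat.le_of_dvd (length_pos_iff.2 hc) c.rotPeriod_dvd_length) hpos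
    omega)
  rw [flatten_replicate_rotRoot] at h
  rw [length_rotRoot hc, ← h]

theorem IsRotated.rotPeriod_eq {c d : List A} (h : c ~r d) : c.rotPeriod = d.rotPeriod := by
  obtain ⟨n, rfl⟩ := h
  refine Nat.dvd_antisymm ?_ ?_
  · rw [← rotate_eq_self_iff_rotPeriod_dvd]
    have h2 : (c.rotate n).rotate (c.rotate n).rotPeriod = c.rotate n :=
      rotate_eq_self_iff_rotPeriod_dvd.2 dvd_rfl
    rw [rotate_rotate, add_comm, ← rotate_rotate, rotate_eq_rotate] at h2
    exact h2
  · rw [← rotate_eq_self_iff_rotPeriod_dvd, rotate_rotate, add_comm, ← rotate_rotate,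
      rotate_eq_self_iff_rotPeriod_dvd.2 dvd_rfl]

theorem IsRotated.isAperiodic_iff {c d : List A} (h : c ~r d) : c.IsAperiodic ↔ d.IsAperiodic := by
  rw [IsAperiodic, IsAperiodic, h.rotPeriod_eq, h.perm.length_eq]
  have : c ≠ [] ↔ d ≠ [] := by rw [← length_pos_iff, ← length_pos_iff, h.perm.length_eq]
  rw [this]

/-- A primitive list has as many rotations as its length. -/
theorem IsAperiodic.ncard_isRotated {c : List A} (hc : c.IsAperiodic) :
    {d : List A | (d : Cycle A) = c}.ncard = c.length := by
  have : {d : List A | (d : Cycle A) = c} = Set.range fun i : Fin c.length => c.rotate i := by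
    ext d
    simp only [Set.mem_ofPred_eq, Cycle.coe_eq_coe, Set.mem_range]
    constructor
    · intro h
      obtain ⟨n, rfl⟩ := h.symm
      exact ⟨⟨n % c.length, Nat.mod_lt _ (length_pos_iff.2 hc.1)⟩, rotate_mod c n⟩
    · rintro ⟨i, rfl⟩
      exact IsRotated.forall c i
  rw [this, ← Set.image_univ, Set.ncard_image_of_injective, Set.ncard_univ, Nat.card_fin]
  have key : ∀ i j : ℕ, i ≤ j → j < c.length → c.rotate i = c.rotate j → i = j := by
    intro i j hij hj h
    obtain ⟨k, rfl⟩ := Nat.exists_eq_add_of_le hij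
    rw [add_comm i k, ← rotate_rotate, rotate_eq_rotate, eq_comm,
      rotate_eq_self_iff_rotPeriod_dvd, hc.2] at h
    have := Nat.eq_zero_of_dvd_of_lt h (by omega)
    omega
  intro i j h
  ext
  rcases le_total i.1 j.1 with hij | hij
  · exact key i j hij j.2 h
  · exact (key j i hij i.2 h.symm).symm

/-- Consecutive entries are related, and so are the last and the first one. -/
def IsCyclicChain (B : A → A → Prop) (c : List A) : Prop :=
  c ≠ [] ∧ c.IsChain B ∧ ∀ a ∈ c.getLast?, ∀ b ∈ c.head?, B a b

theorem isCyclicChain_cons {B : A → A → Prop} {a : A} {l : List A} :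
    (a :: l).IsCyclicChain B ↔ (a :: l ++ [a]).IsChain B := by
  rw [isChain_append]
  simp [IsCyclicChain]

/-- Since `Cycle.Chain` lives on the quotient by rotation, this makes rotation invariance immediate.
-/
theorem isCyclicChain_iff_chain {B : A → A → Prop} {c : List A} :
    c.IsCyclicChain B ↔ c ≠ [] ∧ Cycle.Chain B c := by
  rcases c with _ | ⟨a, l⟩
  · simp [IsCyclicChain]
  · rw [isCyclicChain_cons]
    simp [Cycle.chain_coe_cons]

theorem IsRotated.isCyclicChain_iff {B : A → A → Prop} {c d : List A} (h : c ~r d) :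
    c.IsCyclicChain B ↔ d.IsCyclicChain B := by
  have : c ≠ [] ↔ d ≠ [] := by rw [← length_pos_iff, ← length_pos_iff, h.perm.length_eq]
  rw [isCyclicChain_iff_chain, isCyclicChain_iff_chain, this, Cycle.coe_eq_coe.2 h]

/-- The junctions between consecutive copies of `b` impose only the relation from the last letter of
`b` to its first, which closing up `b` requires anyway. -/
theorem isCyclicChain_flatten_replicate {B : A → A → Prop} {b : List A} {r : ℕ} (hr : r ≠ 0) :
    (replicate r b).flatten.IsCyclicChain B ↔ b.IsCyclicChain B := by
  rcases eq_or_ne b [] with rfl | hb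
  · simp [IsCyclicChain]
  rw [IsCyclicChain, IsCyclicChain, head?_flatten_replicate hr, getLast?_flatten_replicate hr,
    isChain_flatten (by simp [hr, hb.symm])]
  constructor
  · rintro ⟨-, h1, h2⟩
    exact ⟨hb, h1.1 b (by simp [hr]), h2⟩
  · rintro ⟨-, h1, h2⟩
    refine ⟨by simp [hr, hb], ⟨by simpa [hr] using h1, ?_⟩, h2⟩
    exact isChain_replicate_of_rel _ h2

end List

/-! ### The identity `det (1 - M) = exp (-∑ tr Mᵐ / m)`. -/

namespace Matrix

variable {n : Type*} [Fintype n] [DecidableEq n]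

theorem charpolyRev_eval (M : Matrix n n ℂ) (z : ℂ) : M.charpolyRev.eval z = det (1 - z • M) := by
  rw [charpolyRev, ← Polynomial.coe_evalRingHom, RingHom.map_det]
  congr 1
  ext i j
  rcases eq_or_ne i j with hij | hij <;> simp [hij, mul_comm z]

/-- Jacobi's formula: factor `1 - w M = (1 - z M)(1 - (w - z) K M)` and read off the linear
coefficient of the reversed characteristic polynomial of `K M`. -/
theorem hasDerivAt_det_one_sub_smul (M K : Matrix n n ℂ) (z : ℂ) (hK : (1 - z • M) * K = 1) :
    HasDerivAt (fun w : ℂ => det (1 - w • M)) (-(det (1 - z • M) * trace (K * M))) z := by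
  have hK' : K * (1 - z • M) = 1 := mul_eq_one_comm.1 hK
  have h1 : (fun w : ℂ => det (1 - w • M)) =
      fun w => det (1 - z • M) * (K * M).charpolyRev.eval (w - z) := by
    funext w
    rw [charpolyRev_eval, ← det_mul]
    congr 1
    rw [mul_sub, mul_one, mul_smul_comm, ← mul_assoc, hK, one_mul, sub_smul]
    abel
  rw [h1]
  have h2 := HasDerivAt.comp z (h := fun w : ℂ => w - z) ((K * M).charpolyRev.hasDerivAt (z - z))
    ((hasDerivAt_id' z).sub_const z)
  have h3 := h2.const_mul (det (1 - z • M))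
  refine h3.congr_deriv ?_
  rw [sub_self, ← Polynomial.coeff_zero_eq_eval_zero, Polynomial.coeff_derivative]
  simp

attribute [local instance] Matrix.linftyOpNormedRing Matrix.linftyOpNormedAlgebra

/-- Replace `M` by `z M`: by Jacobi's formula and the geometric series the product has derivative
`0` in `z`, so its value at `z = 1` equals its value at `z = 0`. -/
theorem det_one_sub_mul_exp_tsum_trace (M : Matrix n n ℂ) (hM : ‖M‖ < 1) :
    (Summable fun m : ℕ => trace (M ^ (m + 1)) / ((m : ℂ) + 1)) ∧
    det (1 - M) * Complex.exp (∑' m : ℕ, trace (M ^ (m + 1)) / ((m : ℂ) + 1)) = 1 := by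
  -- The radius `ρ = 1 / q` exceeds `1`, so the open ball contains both `0` and `1`, while `ρ * ‖M‖
  -- < 1` keeps the differentiated series uniformly dominated.
  obtain ⟨q, hq, hq1⟩ := exists_between hM
  have hq0 : 0 < q := (norm_nonneg M).trans_lt hq
  set ρ := q⁻¹ with hρ
  have hρ1 : 1 < ρ := (one_lt_inv₀ hq0).2 hq1
  have hρ0 : 0 < ρ := by positivity
  have hρM : ρ * ‖M‖ < 1 := by
    rw [hρ, inv_mul_lt_iff₀ hq0, mul_one]; exact hq
  let g : ℕ → ℂ → Matrix n n ℂ := fun m z => z ^ (m + 1) • (((m : ℂ) + 1)⁻¹ • M ^ (m + 1))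
  let g' : ℕ → ℂ → Matrix n n ℂ := fun m z => z ^ m • M ^ (m + 1)
  have hu : Summable fun m : ℕ => ‖M‖ * (ρ * ‖M‖) ^ m :=
    (summable_geometric_of_lt_one (by positivity) hρM).mul_left _
  have hg : ∀ m, ∀ z ∈ Metric.ball (0 : ℂ) ρ, HasDerivAt (g m) (g' m z) z := by
    intro m z _
    have h := (hasDerivAt_pow (m + 1) z).smul_const (((m : ℂ) + 1)⁻¹ • M ^ (m + 1))
    refine h.congr_deriv ?_
    have : (m : ℂ) + 1 ≠ 0 := by exact_mod_cast Nat.succ_ne_zero m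
    change _ = z ^ m • M ^ (m + 1)
    rw [smul_smul]
    congr 1
    push_cast
    field_simp
  have hbd : ∀ m, ∀ z ∈ Metric.ball (0 : ℂ) ρ, ‖g' m z‖ ≤ ‖M‖ * (ρ * ‖M‖) ^ m := by
    intro m z hz
    rw [mem_ball_zero_iff] at hz
    calc ‖g' m z‖ ≤ ‖z ^ m‖ * ‖M ^ (m + 1)‖ := norm_smul_le _ _
      _ ≤ ρ ^ m * ‖M‖ ^ (m + 1) := by
        rw [norm_pow]
        gcongr
        exact norm_pow_le' M (Nat.succ_pos m)
      _ = _ := by ring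
  have h0 : (0 : ℂ) ∈ Metric.ball (0 : ℂ) ρ := by simpa using hρ0
  have h1 : (1 : ℂ) ∈ Metric.ball (0 : ℂ) ρ := by simpa using hρ1
  have hpre : IsPreconnected (Metric.ball (0 : ℂ) ρ) := (convex_ball 0 ρ).isPreconnected
  have hg0 : Summable fun m => g m 0 := by
    simp [g]
  have hsum1 : Summable fun m => g m 1 :=
    summable_of_summable_hasDerivAt_of_isPreconnected hu Metric.isOpen_ball hpre hg hbd h0 hg0 h1
  have hH := fun z hz => hasDerivAt_tsum_of_isPreconnected hu Metric.isOpen_ball hpre hg hbd h0 hg0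
    (y := z) hz
  let T : Matrix n n ℂ →L[ℂ] ℂ := LinearMap.toContinuousLinearMap (traceLinearMap n ℂ ℂ)
  have hT : ∀ A, T A = trace A := fun A => rfl
  let F : ℂ → ℂ := fun z => det (1 - z • M) * Complex.exp (T (∑' m, g m z))
  have hF : ∀ z ∈ Metric.ball (0 : ℂ) ρ, HasDerivAt F 0 z := by
    intro z hz
    have hzM : ‖z • M‖ < 1 := by
      rw [mem_ball_zero_iff] at hz
      refine (norm_smul_le z M).trans_lt (lt_of_le_of_lt ?_ hρM)
      gcongr
    set K := ∑' i : ℕ, (z • M) ^ i with hKdef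
    have hK : (1 - z • M) * K = 1 := mul_neg_geom_series _ hzM
    have hd := hasDerivAt_det_one_sub_smul M K z hK
    have hKM : ∑' m, g' m z = K * M := by
      have hs : Summable fun i : ℕ => (z • M) ^ i := summable_geometric_of_norm_lt_one hzM
      rw [hKdef, ← hs.tsum_mul_right]
      refine tsum_congr fun m => ?_
      change z ^ m • M ^ (m + 1) = _
      rw [smul_pow, smul_mul_assoc, pow_succ]
    have he := (T.hasFDerivAt.comp_hasDerivAt z (hH z hz)).cexp
    have hmul := hd.mul he
    refine hmul.congr_deriv ?_
    have e : ∀ D t E : ℂ, -(D * t) * E + D * (E * t) = 0 := by intros; ring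
    refine Eq.trans ?_ (e (det (1 - z • M)) (trace (K * M)) (Complex.exp (T (∑' m, g m z))))
    exact congrArg (fun s => -(det (1 - z • M) * trace (K * M)) * Complex.exp (T (∑' m, g m z)) +
      det (1 - z • M) * (Complex.exp (T (∑' m, g m z)) * s)) (congrArg trace hKM)
  have hconst : F 1 = F 0 := by
    refine Metric.isOpen_ball.is_const_of_deriv_eq_zero hpre
      (fun z hz => (hF z hz).differentiableAt.differentiableWithinAt)
      (fun z hz => (hF z hz).deriv) h1 h0
  have hF0 : F 0 = 1 := by simp [F, g]
  have hT1 : HasSum (fun m : ℕ => trace (M ^ (m + 1)) / ((m : ℂ) + 1)) (T (∑' m, g m 1)) := by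
    have e : (fun m : ℕ => trace (M ^ (m + 1)) / ((m : ℂ) + 1)) = fun m => T (g m 1) := by
      funext m
      change _ = trace ((1 : ℂ) ^ (m + 1) • (((m : ℂ) + 1)⁻¹ • M ^ (m + 1)))
      rw [one_pow, one_smul, trace_smul, smul_eq_mul, div_eq_inv_mul]
    rw [e]
    exact T.hasSum hsum1.hasSum
  refine ⟨hT1.summable, ?_⟩
  rw [hT1.tsum_eq]
  simpa [F] using hconst.trans hF0

theorem linfty_opNorm_lt_of_entry_le {M : Matrix n n ℂ} {r : ℝ} (hr : 0 < r)
    (h : ∀ i j, ‖M i j‖ ≤ r / (Fintype.card n + 1)) : ‖M‖ < r := by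
  rw [linfty_opNorm_def]
  lift r to NNReal using hr.le
  rw [NNReal.coe_lt_coe, Finset.sup_lt_iff (by exact_mod_cast hr)]
  intro i _
  rw [← NNReal.coe_lt_coe]
  push_cast
  calc ∑ j, ‖M i j‖ ≤ ∑ j : n, (r : ℝ) / (Fintype.card n + 1) := Finset.sum_le_sum fun j _ => h i j
    _ = Fintype.card n * (r / (Fintype.card n + 1)) := by simp
    _ < r := by
      rw [mul_div_assoc', div_lt_iff₀ (by positivity)]
      nlinarith

end Matrix

/-! ### Sums over closed words and the Euler product over primitive classes. -/

namespace List

variable {A : Type*}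

open Classical in
/-- The weighted transition matrix of a relation. -/
noncomputable def transferMatrix (B : A → A → Prop) (u : A → ℂ) : Matrix A A ℂ :=
  Matrix.of fun a b => if B a b then u a else 0

open Classical in
/-- The product of the values of `u` along a list that closes up to a cycle, and `0` otherwise. -/
noncomputable def cyclicWeight (B : A → A → Prop) (u : A → ℂ) (c : List A) : ℂ :=
  if c.IsCyclicChain B then (c.map u).prod else 0

section
variable [Fintype A]

open Classical in
theorem transferMatrix_pow_apply [DecidableEq A] (B : A → A → Prop) (u : A → ℂ) (m : ℕ) (a b : A) :
    (transferMatrix B u ^ (m + 1)) a b = ∑ f : Fin m → A,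
      if (a :: ofFn f ++ [b]).IsChain B then ((a :: ofFn f).map u).prod else 0 := by
  induction m generalizing a with
  | zero => simp [transferMatrix]
  | succ m ih =>
    rw [pow_succ', Matrix.mul_apply, ← (Fin.consEquiv fun _ => A).sum_comp, Fintype.sum_prod_type]
    refine Finset.sum_congr rfl fun x _ => ?_
    rw [ih, Finset.mul_sum]
    refine Finset.sum_congr rfl fun f _ => ?_
    have : ofFn ((Fin.consEquiv fun _ => A) (x, f)) = x :: ofFn f := by
      simp [Fin.consEquiv, ofFn_succ]
    rw [this]
    by_cases h : B a x <;> simp [transferMatrix, h]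

/-- A diagonal entry sums over walks that return to their first letter, and appending the first
letter to a word is how a cyclic chain becomes an ordinary one. -/
theorem trace_transferMatrix_pow [DecidableEq A] (B : A → A → Prop) (u : A → ℂ) (m : ℕ) :
    Matrix.trace (transferMatrix B u ^ (m + 1)) =
      ∑ f : Fin (m + 1) → A, cyclicWeight B u (ofFn f) := by
  rw [← (Fin.consEquiv fun _ => A).sum_comp, Fintype.sum_prod_type, Matrix.trace]
  refine Finset.sum_congr rfl fun a _ => ?_
  rw [Matrix.diag_apply, transferMatrix_pow_apply]
  refine Finset.sum_congr rfl fun f _ => ?_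
  have : ofFn ((Fin.consEquiv fun _ => A) (a, f)) = a :: ofFn f := by
    simp [Fin.consEquiv, ofFn_succ]
  rw [this, cyclicWeight]
  classical
  exact if_congr isCyclicChain_cons.symm rfl rfl

/-- The words of length `n` contribute `(∑ a, r a) ^ n`, so the sum is geometric. -/
theorem summable_prod_map {r : A → ℝ} (h0 : ∀ a, 0 ≤ r a) (h1 : ∑ a, r a < 1) :
    Summable fun c : List A => (c.map r).prod := by
  rw [← equivSigmaTuple.symm.summable_iff, summable_sigma_of_nonneg]
  · refine ⟨fun n => Summable.of_finite, ?_⟩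
    have : (fun n : ℕ => ∑' f : Fin n → A,
        ((fun c : List A => (c.map r).prod) ∘ equivSigmaTuple.symm) ⟨n, f⟩) =
        fun n => (∑ a, r a) ^ n := by
      funext n
      rw [tsum_fintype, Fintype.sum_pow]
      refine Finset.sum_congr rfl fun f _ => ?_
      simp [equivSigmaTuple, prod_ofFn]
    rw [this]
    exact summable_geometric_of_lt_one (Finset.sum_nonneg fun a _ => h0 a) h1
  · rintro ⟨n, f⟩
    exact prod_nonneg (by simp [h0])

theorem tsum_list {f : List A → ℂ} (hf : Summable f) :
    ∑' c, f c = ∑' n : ℕ, ∑ g : Fin n → A, f (ofFn g) := by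
  rw [← equivSigmaTuple.symm.tsum_eq,
    Summable.tsum_sigma (f := fun c => f (equivSigmaTuple.symm c))
      (equivSigmaTuple.symm.summable_iff.2 hf)]
  refine tsum_congr fun n => ?_
  rw [tsum_fintype]
  rfl

end

theorem norm_prod_map (u : A → ℂ) (c : List A) :
    ‖(c.map u).prod‖ = (c.map fun a => ‖u a‖).prod := by
  induction c with
  | nil => simp
  | cons a l ih => simp [ih]

theorem norm_cyclicWeight_le (B : A → A → Prop) (u : A → ℂ) (c : List A) :
    ‖cyclicWeight B u c‖ ≤ (c.map fun a => ‖u a‖).prod := by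
  rw [← norm_prod_map, cyclicWeight]
  split_ifs
  · rfl
  · simp

theorem summable_cyclicWeight_div [Fintype A] (B : A → A → Prop) {u : A → ℂ}
    (hu : ∑ a, ‖u a‖ < 1) : Summable fun c : List A => cyclicWeight B u c / c.length := by
  refine (summable_prod_map (fun a => norm_nonneg (u a)) hu).of_norm_bounded fun c => ?_
  rw [norm_div, Complex.norm_natCast]
  refine le_trans ?_ (norm_cyclicWeight_le B u c)
  rcases Nat.eq_zero_or_pos c.length with h | h
  · simp [h]
  · exact div_le_self (norm_nonneg _) (by exact_mod_cast h)

theorem tsum_cyclicWeight_div [Fintype A] [DecidableEq A] (B : A → A → Prop) {u : A → ℂ}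
    (hu : ∑ a, ‖u a‖ < 1) : ∑' c : List A, cyclicWeight B u c / c.length =
      ∑' m : ℕ, Matrix.trace (transferMatrix B u ^ (m + 1)) / ((m : ℂ) + 1) := by
  have hs := summable_cyclicWeight_div B hu
  rw [tsum_list hs]
  have hs2 : Summable fun n : ℕ => ∑ g : Fin n → A, cyclicWeight B u (ofFn g) / (ofFn g).length := by
    have := (equivSigmaTuple.symm.summable_iff.2 hs).sigma
    refine this.congr fun n => ?_
    rw [tsum_fintype]
    rfl
  rw [hs2.tsum_eq_zero_add]
  -- The empty word drops out: its length is `0` and division by `0` gives `0`.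
  have : ∑ g : Fin 0 → A, cyclicWeight B u (ofFn g) / (ofFn g).length = 0 := by
    simp
  rw [this, zero_add]
  refine tsum_congr fun m => ?_
  rw [trace_transferMatrix_pow, Finset.sum_div]
  refine Finset.sum_congr rfl fun f _ => ?_
  simp

/-- Primitive cyclic chains. -/
abbrev PrimChain (B : A → A → Prop) : Type _ := {b : List A // b.IsCyclicChain B ∧ b.IsAperiodic}

/-- Every cyclic chain is a power of a primitive one in exactly one way. -/
noncomputable def primChainPowEquiv (B : A → A → Prop) :
    PrimChain B × ℕ ≃ {c : List A // c.IsCyclicChain B} where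
  toFun p := ⟨(replicate (p.2 + 1) p.1.1).flatten,
    (isCyclicChain_flatten_replicate (Nat.succ_ne_zero _)).2 p.1.2.1⟩
  invFun c := (⟨c.1.rotRoot, by
    have hne := c.2.1
    have hr : c.1.length / c.1.rotPeriod ≠ 0 := by
      have := Nat.div_pos (Nat.le_of_dvd (length_pos_iff.2 hne) c.1.rotPeriod_dvd_length)
        (rotPeriod_pos hne)
      omega
    refine ⟨(isCyclicChain_flatten_replicate hr).1 ?_, isAperiodic_rotRoot hne⟩
    rw [flatten_replicate_rotRoot]
    exact c.2⟩, c.1.length / c.1.rotPeriod - 1)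
  left_inv := by
    rintro ⟨⟨b, hb, hne, hper⟩, r⟩
    have hlen : 0 < b.length := length_pos_iff.2 hne
    have hp : (replicate (r + 1) b).flatten.rotPeriod = b.length := by
      rw [rotPeriod_flatten_replicate b (Nat.succ_ne_zero r), hper]
    refine Prod.ext (Subtype.ext ?_) ?_
    · change (replicate (r + 1) b).flatten.rotRoot = b
      rw [rotRoot, hp, replicate_succ, flatten_cons, take_left]
    · change (replicate (r + 1) b).flatten.length / (replicate (r + 1) b).flatten.rotPeriod - 1 = r
      rw [hp, length_flatten_replicate, Nat.mul_div_cancel _ hlen, Nat.add_sub_cancel]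
  right_inv := by
    rintro ⟨c, hc⟩
    have hne := hc.1
    have := Nat.div_pos (Nat.le_of_dvd (length_pos_iff.2 hne) c.rotPeriod_dvd_length)
        (rotPeriod_pos hne)
    refine Subtype.ext ?_
    change (replicate (c.length / c.rotPeriod - 1 + 1) c.rotRoot).flatten = c
    rw [Nat.sub_add_cancel this, flatten_replicate_rotRoot]

/-- Primitive cyclic chains up to rotation. -/
def PrimClass (B : A → A → Prop) : Type _ :=
  {p : Cycle A // ∃ c : List A, (c : Cycle A) = p ∧ c.IsCyclicChain B ∧ c.IsAperiodic}

/-- The product of the values of `u` along a cyclic list. -/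
def cycleWeight (u : A → ℂ) (p : Cycle A) : ℂ := (p.toMultiset.map u).prod

theorem cycleWeight_coe (u : A → ℂ) (c : List A) : cycleWeight u c = (c.map u).prod := by
  simp [cycleWeight]

def PrimChain.toClass {B : A → A → Prop} (b : PrimChain B) : PrimClass B :=
  ⟨b.1, b.1, rfl, b.2⟩

theorem norm_prod_map_lt_one [Fintype A] {u : A → ℂ} (hu : ∑ a, ‖u a‖ < 1) {c : List A}
    (hc : c ≠ []) : ‖(c.map u).prod‖ < 1 := by
  have hu' : ∀ a, ‖u a‖ < 1 := fun a =>
    (Finset.single_le_sum (fun b _ => norm_nonneg (u b)) (Finset.mem_univ a)).trans_lt hu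
  have hle : ∀ l : List A, ‖(l.map u).prod‖ ≤ 1 := by
    intro l
    induction l with
    | nil => simp
    | cons a l ih =>
      rw [map_cons, prod_cons, norm_mul]
      exact mul_le_one₀ (hu' a).le (norm_nonneg _) ih
  rcases c with _ | ⟨a, l⟩
  · exact absurd rfl hc
  · rw [map_cons, prod_cons, norm_mul]
    exact (mul_le_of_le_one_right (norm_nonneg _) (hle l)).trans_lt (hu' a)

theorem prod_map_flatten_replicate (u : A → ℂ) (b : List A) (r : ℕ) :
    ((replicate r b).flatten.map u).prod = (b.map u).prod ^ r := by
  induction r with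
  | zero => simp
  | succ r ih => rw [replicate_succ, flatten_cons, map_append, prod_append, ih, pow_succ']

/-- Rotation preserves closedness and primitivity, so the fibre is a full rotation class, and a
primitive word has as many rotations as letters. -/
theorem natCard_toClass_fiber {B : A → A → Prop} (b : PrimChain B) :
    Nat.card {d : PrimChain B // d.toClass = b.toClass} = b.1.length := by
  rw [← b.2.2.ncard_isRotated, ← Nat.card_coe_set_eq]
  refine Nat.card_congr ⟨fun d => ⟨d.1.1, congrArg Subtype.val d.2⟩, fun d => ⟨⟨d.1, ?_⟩, ?_⟩,
    fun d => rfl, fun d => rfl⟩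
  · have h : d.1 ~r b.1 := Cycle.coe_eq_coe.1 d.2
    rw [h.isCyclicChain_iff, h.isAperiodic_iff]
    exact b.2
  · exact Subtype.ext d.2

/-- Write each closed word as a power `b ^ (r + 1)` of a primitive one. The sum over `r` is the
logarithmic series divided by the length of `b`; summing over the rotations of `b` cancels this
denominator. -/
theorem hasSum_neg_log_primClass [Fintype A] (B : A → A → Prop) {u : A → ℂ}
    (hu : ∑ a, ‖u a‖ < 1) :
    HasSum (fun p : PrimClass B => -Complex.log (1 - cycleWeight u p.1))
      (∑' c : List A, cyclicWeight B u c / c.length) := by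
  have h1 : HasSum (fun c : {c : List A // c.IsCyclicChain B} => cyclicWeight B u c.1 / c.1.length)
      (∑' c : List A, cyclicWeight B u c / c.length) := by
    refine (hasSum_subtype_iff_of_support_subset (s := {c : List A | c.IsCyclicChain B}) ?_).2
      (summable_cyclicWeight_div B hu).hasSum
    intro c hc
    by_contra h
    simp only [Set.mem_ofPred_eq] at h
    simp [cyclicWeight, h] at hc
  have h2 := (primChainPowEquiv B).hasSum_iff.2 h1
  have hlog : ∀ b : PrimChain B, HasSum
      (fun r : ℕ => ((fun c : {c : List A // c.IsCyclicChain B} =>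
        cyclicWeight B u c.1 / c.1.length) ∘ primChainPowEquiv B) (b, r))
      (-Complex.log (1 - cycleWeight u b.toClass.1) / b.1.length) := by
    intro b
    have hne : b.1 ≠ [] := b.2.2.1
    have hlt := norm_prod_map_lt_one hu hne
    have h := Complex.hasSum_taylorSeries_neg_log hlt
    -- The series is indexed from `0`, with vanishing term `z ^ 0 / 0`; the shift aligns it with
    -- exponents `r + 1`.
    rw [← hasSum_nat_add_iff' 1] at h
    simp only [Finset.range_one, Finset.sum_singleton, pow_zero, Nat.cast_zero, div_zero,
      sub_zero] at h
    have h' := h.div_const (b.1.length : ℂ)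
    rw [show cycleWeight u b.toClass.1 = (b.1.map u).prod from cycleWeight_coe u b.1]
    refine Eq.subst (motive := fun f => HasSum f _) (funext fun r => ?_) h'
    change _ = cyclicWeight B u (replicate (r + 1) b.1).flatten /
      (replicate (r + 1) b.1).flatten.length
    rw [cyclicWeight, if_pos ((isCyclicChain_flatten_replicate (Nat.succ_ne_zero r)).2 b.2.1),
      prod_map_flatten_replicate, length_flatten_replicate, div_div]
    push_cast
    rfl
  have h3 := h2.prod_fiberwise hlog
  have h4 := (Equiv.sigmaFiberEquiv (PrimChain.toClass (B := B))).hasSum_iff.2 h3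
  refine h4.sigma fun p => ?_
  obtain ⟨p, c, rfl, hc⟩ := p
  have hcard := natCard_toClass_fiber (⟨c, hc⟩ : PrimChain B)
  have hpos : 0 < c.length := length_pos_iff.2 hc.2.1
  have : Finite {d : PrimChain B // d.toClass = PrimChain.toClass ⟨c, hc⟩} :=
    Nat.finite_of_card_ne_zero (by rw [hcard]; exact hpos.ne')
  have : Fintype {d : PrimChain B // d.toClass = PrimChain.toClass ⟨c, hc⟩} := Fintype.ofFinite _
  have h5 := hasSum_fintype fun d : {d : PrimChain B // d.toClass = PrimChain.toClass ⟨c, hc⟩} =>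
    -Complex.log (1 - cycleWeight u d.1.toClass.1) / d.1.1.length
  have h6 : ∀ d : {d : PrimChain B // d.toClass = PrimChain.toClass ⟨c, hc⟩},
      -Complex.log (1 - cycleWeight u d.1.toClass.1) / (d.1.1.length : ℂ) =
        -Complex.log (1 - cycleWeight u (c : Cycle A)) / c.length := by
    intro d
    have h : d.1.1 ~r c := Cycle.coe_eq_coe.1 (congrArg Subtype.val d.2)
    rw [d.2, h.perm.length_eq]
    rfl
  have h7 : ∑ d : {d : PrimChain B // d.toClass = PrimChain.toClass ⟨c, hc⟩},
      -Complex.log (1 - cycleWeight u d.1.toClass.1) / (d.1.1.length : ℂ) =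
        -Complex.log (1 - cycleWeight u (c : Cycle A)) := by
    rw [Finset.sum_congr rfl fun d _ => h6 d, Finset.sum_const, Finset.card_univ,
      ← Nat.card_eq_fintype_card, hcard, nsmul_eq_mul]
    have : (c.length : ℂ) ≠ 0 := by exact_mod_cast hpos.ne'
    field_simp
  rw [h7] at h5
  exact h5

attribute [local instance] Matrix.linftyOpNormedRing Matrix.linftyOpNormedAlgebra

/-- The Euler product over primitive classes is the reciprocal of a determinant. -/
theorem tprod_primClass [Fintype A] [DecidableEq A] (B : A → A → Prop) {u : A → ℂ}
    (hu : ∑ a, ‖u a‖ < 1) (hM : ‖transferMatrix B u‖ < 1) :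
    ∏' p : PrimClass B, (1 - cycleWeight u p.1)⁻¹ = (Matrix.det (1 - transferMatrix B u))⁻¹ := by
  have hlt : ∀ p : PrimClass B, ‖cycleWeight u p.1‖ < 1 := by
    rintro ⟨p, c, rfl, hc⟩
    rw [cycleWeight_coe]
    exact norm_prod_map_lt_one hu hc.1.1
  have hre : ∀ p : PrimClass B, 0 < (1 - cycleWeight u p.1).re := by
    intro p
    have := (Complex.re_le_norm (cycleWeight u p.1)).trans_lt (hlt p)
    simp only [Complex.sub_re, Complex.one_re]
    linarith
  have hne : ∀ p : PrimClass B, (1 - cycleWeight u p.1) ≠ 0 := by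
    intro p h
    have := hre p
    rw [h] at this
    simp at this
  have hinv : ∀ p : PrimClass B,
      Complex.log (1 - cycleWeight u p.1)⁻¹ = -Complex.log (1 - cycleWeight u p.1) := by
    intro p
    -- The factor has positive real part, so it avoids the branch cut.
    refine Complex.log_inv _ fun h => ?_
    rw [Complex.arg_eq_pi_iff] at h
    exact absurd h.1 (not_lt.2 (hre p).le)
  have h1 := hasSum_neg_log_primClass B hu
  have h2 : HasSum (fun p : PrimClass B => Complex.log (1 - cycleWeight u p.1)⁻¹)
      (∑' c : List A, cyclicWeight B u c / c.length) := by
    simpa only [hinv] using h1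
  rw [← Complex.cexp_tsum_eq_tprod (fun p => inv_ne_zero (hne p)) h2.summable, h2.tsum_eq,
    tsum_cyclicWeight_div B hu]
  exact eq_inv_of_mul_eq_one_right (Matrix.det_one_sub_mul_exp_tsum_trace _ hM).2

end List

/-! ### Recovering a determinant from `det (1 - t N)` near `0`. -/

namespace Matrix

variable {n m : Type*} [Fintype n] [DecidableEq n] [Fintype m] [DecidableEq m]

theorem charpoly_eval_eq (K : Matrix n n ℂ) {s : ℂ} (hs : s ≠ 0) :
    K.charpoly.eval s = s ^ Fintype.card n * K.charpolyRev.eval s⁻¹ := by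
  rw [eval_charpoly, charpolyRev_eval, ← det_smul, smul_sub, smul_smul, mul_inv_cancel₀ hs,
    one_smul, scalar_apply, ← smul_one_eq_diagonal]

/-- Agreement near `0` identifies the reversed characteristic polynomials. Reversal loses the power
of `X`, that is the zero eigenvalues; equality of the sizes restores it. -/
theorem det_eq_of_eventually_det_one_sub_smul_eq {N : Matrix n n ℂ} {M : Matrix m m ℂ}
    (hc : Fintype.card n = Fintype.card m)
    (h : ∀ᶠ t : ℂ in nhds 0, det (1 - t • N) = det (1 - t • M)) : det N = det M := by
  have h1 : N.charpolyRev = M.charpolyRev := by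
    refine Polynomial.eq_of_infinite_eval_eq _ _ (infinite_of_mem_nhds 0 ?_)
    filter_upwards [h] with t ht
    simpa only [Set.mem_ofPred_eq, charpolyRev_eval] using ht
  have h2 : N.charpoly = M.charpoly := by
    refine Polynomial.eq_of_infinite_eval_eq _ _ ?_
    refine Set.Infinite.mono (s := {0}ᶜ) ?_ (Set.finite_singleton (0 : ℂ)).infinite_compl
    intro s hs
    rw [Set.mem_ofPred_eq, charpoly_eval_eq N hs, charpoly_eval_eq M hs, hc, h1]
  rw [det_eq_sign_charpoly_coeff, det_eq_sign_charpoly_coeff, h2, hc]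

end Matrix

/-! ### Determinants of non-backtracking matrices. -/

section ArcSystem

variable {A V : Type*} [Fintype A] [DecidableEq A] [Fintype V] [DecidableEq V]

/-- The `0`-`1` matrix of a relation. -/
noncomputable def relMatrix (B : A → A → Prop) : Matrix A A ℂ :=
  List.transferMatrix B 1

/-- Letters of weight `0` have rows of the identity matrix, so the matrix is block triangular with
an identity block. -/
theorem det_one_sub_transferMatrix_indicator (B : A → A → Prop) (p : A → Prop) [DecidablePred p]
    (t : ℂ) : Matrix.det (1 - List.transferMatrix B fun a => if p a then t else 0) =
      Matrix.det (1 - t • relMatrix fun a b : {a // p a} => B a b) := by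
  classical
  rw [Matrix.twoBlockTriangular_det _ p]
  · have h1 : Matrix.toSquareBlockProp
        (1 - List.transferMatrix B fun a => if p a then t else 0) (fun a => ¬ p a) = 1 := by
      ext ⟨i, hi⟩ ⟨j, hj⟩
      simp [Matrix.toSquareBlockProp, List.transferMatrix, hi, Matrix.one_apply]
    rw [h1, Matrix.det_one, mul_one]
    congr 1
    ext ⟨i, hi⟩ ⟨j, hj⟩
    simp [Matrix.toSquareBlockProp, List.transferMatrix, relMatrix, hi, Matrix.one_apply]
  · intro i hi j hj
    have : i ≠ j := by rintro rfl; exact hi hj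
    simp [List.transferMatrix, hi, this]

/-- The non-backtracking matrix of a system of arcs has, up to sign, determinant `∏ (1 - deg)`. -/
theorem det_relMatrix_nonbacktracking (src : A → V) (rev : Equiv.Perm A)
    (hrev : ∀ a, rev (rev a) = a) :
    Matrix.det (relMatrix fun a b => src (rev a) = src b ∧ a ≠ rev b) =
      (Equiv.Perm.sign rev : ℤ) * (-1) ^ Fintype.card A *
        ∏ v, (1 - (Fintype.card {a // src a = v} : ℂ)) := by
  classical
  set N := relMatrix fun a b : A => src (rev a) = src b ∧ a ≠ rev b with hN
  let P : Matrix A V ℂ := Matrix.of fun a v => if src a = v then 1 else 0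
  -- After reversal of the row index, the entry at `a, b` asks for equal origins and `a ≠ b`: this
  -- is `P Pᵀ` minus the identity. Sylvester's identity then passes to `Pᵀ P`, which is diagonal
  -- with the degrees as entries.
  have h1 : N.submatrix rev id = -(1 - P * P.transpose) := by
    ext a b
    have : (rev a ≠ rev b) ↔ a ≠ b := rev.injective.ne_iff
    simp only [hN, relMatrix, List.transferMatrix, Matrix.submatrix_apply, Matrix.of_apply, hrev,
      id, this, Matrix.neg_apply, Matrix.sub_apply, Matrix.mul_apply, Matrix.transpose_apply, P,
      Pi.one_apply]
    by_cases hab : a = b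
    · subst hab
      simp
    · by_cases hs : src a = src b <;> simp [hab, hs]
  have h2 : (1 : Matrix V V ℂ) - P.transpose * P =
      Matrix.diagonal fun v => 1 - (Fintype.card {a // src a = v} : ℂ) := by
    ext v w
    simp only [Matrix.sub_apply, Matrix.mul_apply, Matrix.transpose_apply, P, Matrix.of_apply]
    by_cases hvw : v = w
    · subst hvw
      simp [Fintype.card_subtype, Finset.sum_ite, Finset.filter_filter]
    · have : ∀ a, (if src a = v then (1 : ℂ) else 0) * (if src a = w then 1 else 0) = 0 := by
        intro a
        by_cases h : src a = v
        · have : src a ≠ w := fun h' => hvw (h.symm.trans h')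
          simp [this]
        · simp [h]
      simp [this, hvw]
  have h3 := Matrix.det_permute rev N
  rw [h1, Matrix.det_neg, Matrix.det_one_sub_mul_comm, h2, Matrix.det_diagonal] at h3
  have hs : ((Equiv.Perm.sign rev : ℤ) : ℂ) * (Equiv.Perm.sign rev : ℤ) = 1 := by
    rw [← Int.cast_mul, ← Units.val_mul, Int.units_mul_self]
    simp
  rw [mul_assoc, h3, ← mul_assoc, hs, one_mul]

end ArcSystem

/-! ### Multigraphs given by the ends of their edges -/

section Ends

variable {V E : Type*} [DecidableEq V]

/-- The number of ends of the edge `e` at the vertex `v`. -/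
def endCount (s t : E → V) (v : V) (e : E) : ℤ :=
  (if s e = v then 1 else 0) + if t e = v then 1 else 0

/-- The number of ends at `v` of the edges in `R`. -/
def degIn (s t : E → V) (R : Finset E) (v : V) : ℤ := ∑ e ∈ R, endCount s t v e

/-- The product of `1 - deg v` over all vertices, for the subgraph with edges in `R`. -/
def defect [Fintype V] (s t : E → V) (R : Finset E) : ℤ := ∏ v, (1 - degIn s t R v)

end Ends

/-! ### Arcs as oriented edges, and the determinant formula for the edge zeta function. -/

namespace Graph

variable {α β : Type*} (G : Graph α β)

theorem exists_ends (e : E(G)) : ∃ p : V(G) × V(G), G.IsLink e p.1 p.2 := by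
  obtain ⟨x, y, h⟩ := G.exists_isLink_of_mem_edgeSet e.2
  exact ⟨(⟨x, h.left_mem⟩, ⟨y, h.right_mem⟩), h⟩

/-- The first end of an edge, in an arbitrary orientation. -/
noncomputable def fstEnd (e : E(G)) : V(G) := (G.exists_ends e).choose.1

/-- The second end of an edge, in an arbitrary orientation. -/
noncomputable def sndEnd (e : E(G)) : V(G) := (G.exists_ends e).choose.2

theorem isLink_ends (e : E(G)) : G.IsLink e (G.fstEnd e) (G.sndEnd e) :=
  (G.exists_ends e).choose_spec

/-- The source of an arc, as an element of the vertex set. -/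
def Arc.source {G : Graph α β} (a : G.Arc) : V(G) := ⟨a.src, a.isLink.left_mem⟩

/-- The edge of an arc, as an element of the edge set. -/
def Arc.toEdge {G : Graph α β} (a : G.Arc) : E(G) := ⟨a.edge, a.isLink.edge_mem⟩

open Classical in
/-- The arc that travels along `e` in one of the two directions. -/
noncomputable def mkArc (p : E(G) × Bool) : G.Arc where
  edge := p.1
  src := if p.2 then G.sndEnd p.1 else G.fstEnd p.1
  tgt := if p.2 then G.fstEnd p.1 else G.sndEnd p.1
  side := if G.fstEnd p.1 = G.sndEnd p.1 then p.2 else false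
  isLink := by
    split_ifs
    · exact (G.isLink_ends p.1).symm
    · exact G.isLink_ends p.1
  side_eq h := by
    rw [if_neg]
    intro h'
    simp [h'] at h

theorem mkArc_bijective : Function.Bijective G.mkArc := by
  constructor
  · rintro ⟨e, b⟩ ⟨e', b'⟩ h
    have he : e = e' := Subtype.ext (congrArg Arc.edge h)
    subst he
    have hsrc := congrArg Arc.src h
    have hside := congrArg Arc.side h
    by_cases hl : G.fstEnd e = G.sndEnd e
    · simp only [mkArc, hl, if_true] at hside
      rw [hside]
    · have hl' : (G.fstEnd e : α) ≠ G.sndEnd e := fun h => hl (Subtype.ext h)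
      cases b <;> cases b' <;> simp [mkArc, hl', hl'.symm] at hsrc ⊢
  · intro a
    have hl := (G.isLink_ends a.toEdge).eq_and_eq_or_eq_and_eq a.isLink
    -- The two arcs of a loop differ only in `side`; for other edges `side` is forced and the source
    -- tells the arcs apart.
    by_cases hloop : G.fstEnd a.toEdge = G.sndEnd a.toEdge
    · refine ⟨(a.toEdge, a.side), ?_⟩
      rw [hloop] at hl
      ext
      · rfl
      · rcases hl with hl | hl <;> simp [mkArc, hloop, ← hl.1, ← hl.2]
      · rcases hl with hl | hl <;> simp [mkArc, hloop, ← hl.1, ← hl.2]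
      · simp [mkArc, hloop]
    · have hne : (G.fstEnd a.toEdge : α) ≠ G.sndEnd a.toEdge := fun h => hloop (Subtype.ext h)
      have hside : a.side = false := a.side_eq (by
        rcases hl with hl | hl
        · rw [← hl.1, ← hl.2]; exact hne
        · rw [← hl.1, ← hl.2]; exact hne.symm)
      rcases hl with hl | hl
      · refine ⟨(a.toEdge, false), ?_⟩
        ext
        · rfl
        all_goals simp [mkArc, hloop, ← hl.1, ← hl.2, hside]
      · refine ⟨(a.toEdge, true), ?_⟩
        ext
        · rfl
        all_goals simp [mkArc, hloop, ← hl.1, ← hl.2, hside]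

/-- Arcs are edges with a direction. -/
noncomputable def arcEquiv : E(G) × Bool ≃ G.Arc := Equiv.ofBijective _ G.mkArc_bijective

theorem toEdge_mkArc (p : E(G) × Bool) : (G.mkArc p).toEdge = p.1 := rfl

theorem source_mkArc (p : E(G) × Bool) :
    (G.mkArc p).source = if p.2 then G.sndEnd p.1 else G.fstEnd p.1 := by
  apply Subtype.ext
  cases h : p.2 <;> simp [Arc.source, mkArc, h]

theorem toEdge_rev {G : Graph α β} (a : G.Arc) : a.rev.toEdge = a.toEdge := rfl

/-- An edge carries just two arcs, and reversal fixes none. -/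
theorem eq_or_eq_rev_of_toEdge_eq {G : Graph α β} {a b : G.Arc} (h : a.toEdge = b.toEdge) :
    a = b ∨ a = b.rev := by
  obtain ⟨⟨e, i⟩, rfl⟩ := G.mkArc_bijective.2 a
  obtain ⟨⟨e', j⟩, rfl⟩ := G.mkArc_bijective.2 b
  obtain ⟨⟨e'', k⟩, hk⟩ := G.mkArc_bijective.2 (G.mkArc (e', j)).rev
  have h2 : e'' = e' := by
    have := congrArg Arc.toEdge hk
    simpa only [toEdge_mkArc, toEdge_rev] using this
  simp only [toEdge_mkArc] at h
  subst h h2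
  rw [← hk]
  have hkj : k ≠ j := by
    rintro rfl
    exact Arc.rev_ne _ hk.symm
  cases i <;> cases j <;> cases k <;> simp at hkj ⊢

instance [Finite E(G)] : Finite G.Arc := Finite.of_equiv _ G.arcEquiv

/-- `b` may follow `a` in a walk without backtracking. -/
def Follows (a b : G.Arc) : Prop := a.tgt = b.src ∧ a ≠ b.rev

/-- Having no tail is the no-backtracking condition at the closing junction. If a closed walk is a
power of a word, that word closes up too, so requiring the root to be a cycle does not weaken
primitivity. -/
theorem primeCycle_iff (c : List G.Arc) :
    (G.IsCycle c ∧ ¬ G.HasBacktracking c ∧ ¬ G.HasTail c ∧ G.IsPrimitive c) ↔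
      c.IsCyclicChain G.Follows ∧ c.IsAperiodic := by
  have h1 : (G.IsCycle c ∧ ¬ G.HasBacktracking c ∧ ¬ G.HasTail c) ↔
      c.IsCyclicChain G.Follows := by
    unfold IsCycle HasBacktracking HasTail List.IsCyclicChain Follows
    have hch : c.IsChain (fun a b => a.tgt = b.src ∧ a ≠ b.rev) ↔
        c.IsChain (fun a b => a.tgt = b.src) ∧ c.IsChain (fun a b => a ≠ b.rev) := by
      constructor
      · exact fun h => ⟨h.imp fun _ _ h => h.1, h.imp fun _ _ h => h.2⟩
      · rintro ⟨h, h'⟩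
        rw [List.isChain_iff_getElem] at h h' ⊢
        exact fun i hi => ⟨h i hi, h' i hi⟩
    rw [hch]
    push Not
    constructor
    · rintro ⟨⟨h1, h2, h3⟩, h4, h5⟩
      refine ⟨h1, ⟨h2, h4⟩, fun a ha b hb => ⟨h3 a ha b hb, fun hab => ?_⟩⟩
      refine h5 b hb a ha ?_
      rw [hab, Arc.rev_rev]
    · rintro ⟨h1, ⟨h2, h4⟩, h3⟩
      refine ⟨⟨h1, h2, fun a ha b hb => (h3 a ha b hb).1⟩, h4, fun a ha b hb hab => ?_⟩
      refine (h3 b hb a ha).2 ?_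
      rw [hab, Arc.rev_rev]
  rw [← h1]
  constructor
  · rintro ⟨h2, h3, h4, h5⟩
    refine ⟨⟨h2, h3, h4⟩, (List.isAperiodic_iff h2.1).2 ?_⟩
    rintro ⟨b, r, hr, hb⟩
    refine h5 ⟨b, r, ?_, hr, hb⟩
    have h6 := h1.1 ⟨h2, h3, h4⟩
    rw [hb, List.isCyclicChain_flatten_replicate (by omega)] at h6
    exact ⟨h6.1, h6.2.1.imp fun _ _ h => h.1, fun a ha b hb => (h6.2.2 a ha b hb).1⟩
  · rintro ⟨⟨h2, h3, h4⟩, h5⟩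
    refine ⟨h2, h3, h4, ?_⟩
    rintro ⟨b, r, -, hr, hb⟩
    exact (List.isAperiodic_iff h2.1).1 h5 ⟨b, r, hr, hb⟩

theorem edgeZeta_eq_tprod (u : G.Arc → ℂ) :
    G.edgeZeta u = ∏' p : List.PrimClass G.Follows, (1 - List.cycleWeight u p.1)⁻¹ := by
  let e : G.PrimeCycle ≃ List.PrimClass G.Follows :=
    Equiv.subtypeEquivRight fun p => exists_congr fun c =>
      and_congr_right fun _ => G.primeCycle_iff c
  exact e.tprod_eq fun p : List.PrimClass G.Follows => (1 - List.cycleWeight u p.1)⁻¹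

attribute [local instance] Matrix.linftyOpNormedRing Matrix.linftyOpNormedAlgebra

/-- The determinant formula for the edge zeta function. -/
theorem eventually_edgeZeta_eq [Fintype G.Arc] [DecidableEq G.Arc] :
    ∀ᶠ u : G.Arc → ℂ in nhds 0,
      G.edgeZeta u = (Matrix.det (1 - List.transferMatrix G.Follows u))⁻¹ := by
  have h1 : ∀ᶠ u : G.Arc → ℂ in nhds 0, ∑ a, ‖u a‖ < 1 := by
    have hc : Continuous fun u : G.Arc → ℂ => ∑ a, ‖u a‖ := by fun_prop
    exact hc.continuousAt.eventually_lt continuousAt_const (by simp)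
  have h2 : ∀ᶠ u : G.Arc → ℂ in nhds 0, ∀ a, ‖u a‖ < 1 / (Fintype.card G.Arc + 1) := by
    rw [Filter.eventually_all]
    intro a
    have hc : Continuous fun u : G.Arc → ℂ => ‖u a‖ := by fun_prop
    exact hc.continuousAt.eventually_lt continuousAt_const (by simp; positivity)
  filter_upwards [h1, h2] with u hu hu2
  rw [edgeZeta_eq_tprod]
  refine List.tprod_primClass _ hu (Matrix.linfty_opNorm_lt_of_entry_le one_pos fun i j => ?_)
  simp only [List.transferMatrix, Matrix.of_apply]
  split_ifs
  · exact (hu2 i).le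
  · simp; positivity

open Classical in
theorem card_arc_source_eq_degIn [Fintype G.Arc] (R : Finset E(G)) (v : V(G)) :
    (Fintype.card {a : {a : G.Arc // a.toEdge ∈ R} // a.1.source = v} : ℤ) =
      degIn G.fstEnd G.sndEnd R v := by
  have h1 : Fintype.card {a : {a : G.Arc // a.toEdge ∈ R} // a.1.source = v} =
      Fintype.card {p : R × Bool // (G.mkArc (p.1, p.2)).source = v} := by
    refine (Fintype.card_congr ?_).symm
    refine Equiv.subtypeEquiv (Equiv.ofBijective
      (fun p : R × Bool => ⟨G.mkArc (p.1, p.2), p.1.2⟩) ⟨?_, ?_⟩) fun _ => Iff.rfl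
    · rintro ⟨e, b⟩ ⟨e', b'⟩ h
      have := G.mkArc_bijective.1 (congrArg Subtype.val h)
      simp only [Prod.mk.injEq, SetLike.coe_eq_coe] at this
      exact Prod.ext this.1 this.2
    · rintro ⟨a, ha⟩
      obtain ⟨⟨e, b⟩, rfl⟩ := G.mkArc_bijective.2 a
      exact ⟨(⟨e, ha⟩, b), rfl⟩
  rw [h1, Fintype.card_subtype, Finset.card_filter]
  push_cast
  rw [Fintype.sum_prod_type, degIn, ← Finset.sum_coe_sort R]
  refine Finset.sum_congr rfl fun e _ => ?_
  simp only [source_mkArc, endCount, Fintype.sum_bool]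
  simp [add_comm]

end Graph

/-! ### The zeta function determines the defects of all sets of edges. -/

namespace Graph

variable {α β α' β' : Type*}

/-- The bijection of edges induced by a bijection of arcs that preserves inversion. -/
noncomputable def edgeEquivOfArcEquiv {X : Graph α β} {Y : Graph α' β'} (σ : X.Arc ≃ Y.Arc)
    (hσ : ∀ a : X.Arc, σ a.rev = (σ a).rev) : E(X) ≃ E(Y) :=
  Equiv.ofBijective (fun e => (σ (X.mkArc (e, false))).toEdge) (by
    constructor
    · intro e e' h
      rcases eq_or_eq_rev_of_toEdge_eq h with h | h
      · exact congrArg Arc.toEdge (σ.injective h)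
      · rw [← hσ] at h
        have := congrArg Arc.toEdge (σ.injective h)
        rwa [toEdge_rev] at this
    · intro e
      obtain ⟨a, ha⟩ := σ.surjective (Y.mkArc (e, false))
      refine ⟨a.toEdge, ?_⟩
      rcases eq_or_eq_rev_of_toEdge_eq (a := X.mkArc (a.toEdge, false)) (b := a) rfl with h | h
      · simp only [h, ha, toEdge_mkArc]
      · simp only [h, hσ, toEdge_rev, ha, toEdge_mkArc])

theorem edgeEquivOfArcEquiv_toEdge {X : Graph α β} {Y : Graph α' β'} (σ : X.Arc ≃ Y.Arc)
    (hσ : ∀ a : X.Arc, σ a.rev = (σ a).rev) (a : X.Arc) :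
    edgeEquivOfArcEquiv σ hσ a.toEdge = (σ a).toEdge := by
  change (σ (X.mkArc (a.toEdge, false))).toEdge = _
  rcases eq_or_eq_rev_of_toEdge_eq (a := X.mkArc (a.toEdge, false)) (b := a) rfl with h | h
  · rw [h]
  · rw [h, hσ, toEdge_rev]

/-- Inversion of the arcs whose edges lie in `R`. -/
noncomputable def revPerm (X : Graph α β) (R : Finset E(X)) :
    Equiv.Perm {a : X.Arc // a.toEdge ∈ R} where
  toFun a := ⟨a.1.rev, a.2⟩
  invFun a := ⟨a.1.rev, a.2⟩
  left_inv a := Subtype.ext a.1.rev_rev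
  right_inv a := Subtype.ext a.1.rev_rev

open Classical in
theorem det_relMatrix_follows (X : Graph α β) [Fintype V(X)] [Fintype X.Arc] (R : Finset E(X)) :
    Matrix.det (relMatrix fun a b : {a : X.Arc // a.toEdge ∈ R} => X.Follows a.1 b.1) =
      (Equiv.Perm.sign (X.revPerm R) : ℤ) *
        (-1) ^ Fintype.card {a : X.Arc // a.toEdge ∈ R} *
        (defect X.fstEnd X.sndEnd R : ℂ) := by
  have h1 : (fun a b : {a : X.Arc // a.toEdge ∈ R} => X.Follows a.1 b.1) =
      fun a b => (X.revPerm R a).1.source = b.1.source ∧ a ≠ X.revPerm R b := by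
    funext a b
    simp only [Follows, Arc.source, ne_eq, Subtype.ext_iff]
    rfl
  rw [h1, det_relMatrix_nonbacktracking (fun a => a.1.source) (X.revPerm R)
    fun a => Subtype.ext a.1.rev_rev, defect]
  push_cast
  congr 1
  refine Finset.prod_congr rfl fun v _ => ?_
  rw [← card_arc_source_eq_degIn]
  push_cast
  rfl

open Classical in
/-- The edge zeta function determines the numbers `∏ (1 - deg)` of all edge-induced subgraphs. -/
theorem defect_eq_of_edgeZeta_eq (X : Graph α β) [Fintype V(X)] [Finite E(X)]
    (Y : Graph α' β') [Fintype V(Y)] [Finite E(Y)]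
    (σ : X.Arc ≃ Y.Arc) (hσ : ∀ a : X.Arc, σ a.rev = (σ a).rev)
    (hζ : ∀ᶠ u : Y.Arc → ℂ in nhds 0, X.edgeZeta (fun a => u (σ a)) = Y.edgeZeta u)
    (R : Finset E(X)) :
    defect X.fstEnd X.sndEnd R =
      defect Y.fstEnd Y.sndEnd (R.map (edgeEquivOfArcEquiv σ hσ).toEmbedding) := by
  have : Fintype X.Arc := Fintype.ofFinite _
  have : Fintype Y.Arc := Fintype.ofFinite _
  set R' := R.map (edgeEquivOfArcEquiv σ hσ).toEmbedding with hR'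
  have hmem : ∀ a : X.Arc, a.toEdge ∈ R ↔ (σ a).toEdge ∈ R' := by
    intro a
    rw [hR', ← edgeEquivOfArcEquiv_toEdge σ hσ a]
    simp
  let e : {a : X.Arc // a.toEdge ∈ R} ≃ {a : Y.Arc // a.toEdge ∈ R'} := σ.subtypeEquiv hmem
  have hcard : Fintype.card {a : X.Arc // a.toEdge ∈ R} =
      Fintype.card {a : Y.Arc // a.toEdge ∈ R'} := Fintype.card_congr e
  -- The arc bijection conjugates one reversal into the other, so the signs in the two determinant
  -- formulas agree.
  have hsign : Equiv.Perm.sign (X.revPerm R) = Equiv.Perm.sign (Y.revPerm R') :=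
    Equiv.Perm.sign_eq_sign_of_equiv _ _ e fun a => Subtype.ext (hσ a.1)
  have hdet : Matrix.det (relMatrix fun a b : {a : X.Arc // a.toEdge ∈ R} => X.Follows a.1 b.1) =
      Matrix.det (relMatrix fun a b : {a : Y.Arc // a.toEdge ∈ R'} => Y.Follows a.1 b.1) := by
    refine Matrix.det_eq_of_eventually_det_one_sub_smul_eq hcard ?_
    have hX := X.eventually_edgeZeta_eq
    have hY := Y.eventually_edgeZeta_eq
    have hcont : Continuous fun u : Y.Arc → ℂ => fun a : X.Arc => u (σ a) := by fun_prop
    have hX' : ∀ᶠ u : Y.Arc → ℂ in nhds 0, X.edgeZeta (fun a => u (σ a)) =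
        (Matrix.det (1 - List.transferMatrix X.Follows fun a => u (σ a)))⁻¹ :=
      (hcont.tendsto' 0 0 rfl).eventually hX
    have hall := hζ.and (hX'.and hY)
    -- Weight `0` off `R'` suppresses all cycles that leave `R'`; what remains is a function of `t`
    -- alone.
    let v : ℂ → Y.Arc → ℂ := fun t a => if a.toEdge ∈ R' then t else 0
    have hv : Filter.Tendsto v (nhds 0) (nhds 0) := by
      have : Continuous v := by
        refine continuous_pi fun a => ?_
        by_cases h : a.toEdge ∈ R' <;> simp only [v, h, if_true, if_false] <;> fun_prop
      refine this.tendsto' 0 0 ?_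
      funext a
      simp [v]
    filter_upwards [hv.eventually hall] with t ht
    obtain ⟨h1, h2, h3⟩ := ht
    rw [h2, h3, inv_inj] at h1
    have hv' : (fun a : X.Arc => v t (σ a)) = fun a => if a.toEdge ∈ R then t else 0 := by
      funext a
      simp only [v, hmem]
    rw [hv', det_one_sub_transferMatrix_indicator, det_one_sub_transferMatrix_indicator] at h1
    exact h1
  rw [det_relMatrix_follows, det_relMatrix_follows, hsign, hcard] at hdet
  have hne : ((Equiv.Perm.sign (Y.revPerm R') : ℤ) : ℂ) *
      (-1) ^ Fintype.card {a : Y.Arc // a.toEdge ∈ R'} ≠ 0 := by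
    refine mul_ne_zero ?_ (pow_ne_zero _ (by norm_num))
    rw [Int.cast_ne_zero]
    exact Units.ne_zero _
  exact_mod_cast mul_left_cancel₀ hne hdet

end Graph

/-! ### Reading off the adjacency of edges from defects. -/

section EndsLemmas

variable {V E : Type*} [DecidableEq V]

/-- The vertex `v` is an end of the edge `e`. -/
def IsEnd (s t : E → V) (v : V) (e : E) : Prop := s e = v ∨ t e = v

theorem endCount_nonneg (s t : E → V) (v : V) (e : E) : 0 ≤ endCount s t v e := by
  unfold endCount; split_ifs <;> norm_num

theorem endCount_eq_zero {s t : E → V} {v : V} {e : E} (h : ¬ IsEnd s t v e) :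
    endCount s t v e = 0 := by
  simp only [IsEnd, not_or] at h
  simp [endCount, h.1, h.2]

theorem endCount_of_loop {s t : E → V} {v : V} {e : E} (hl : s e = t e) (h : IsEnd s t v e) :
    endCount s t v e = 2 := by
  rcases h with h | h
  · simp [endCount, ← hl, h]
  · simp [endCount, hl, h]

theorem endCount_of_ne {s t : E → V} {v : V} {e : E} (hl : s e ≠ t e) (h : IsEnd s t v e) :
    endCount s t v e = 1 := by
  rcases h with h | h
  · subst h; simp [endCount, hl.symm]
  · subst h; simp [endCount, hl]

theorem endCount_pos {s t : E → V} {v : V} {e : E} (h : IsEnd s t v e) :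
    1 ≤ endCount s t v e := by
  by_cases hl : s e = t e
  · rw [endCount_of_loop hl h]; norm_num
  · rw [endCount_of_ne hl h]

theorem defect_ne_zero_iff [Fintype V] {s t : E → V} {R : Finset E} :
    defect s t R ≠ 0 ↔ ∀ v, degIn s t R v ≠ 1 := by
  rw [defect, Finset.prod_ne_zero_iff]
  refine ⟨fun h v hv => h v (Finset.mem_univ v) (by rw [hv, sub_self]), fun h v _ hv => h v ?_⟩
  linarith

variable [DecidableEq E]

theorem degIn_erase {s t : E → V} {R : Finset E} (v : V) {e : E} (he : e ∈ R) :
    degIn s t (R.erase e) v = degIn s t R v - endCount s t v e := by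
  have := Finset.sum_erase_add R (fun e => endCount s t v e) he
  simp only [degIn]
  linarith

theorem degIn_pair {s t : E → V} (v : V) {e f : E} (hef : e ≠ f) :
    degIn s t {e, f} v = endCount s t v e + endCount s t v f := by
  rw [degIn, Finset.sum_pair hef]

theorem degIn_triple {s t : E → V} (v : V) {e f g : E} (hef : e ≠ f) (heg : e ≠ g) (hfg : f ≠ g) :
    degIn s t {e, f, g} v = endCount s t v e + endCount s t v f + endCount s t v g := by
  rw [degIn, Finset.sum_insert (by simp [hef, heg]), Finset.sum_pair hfg, add_assoc]

/-- Every vertex has degree at least `3`, or carries a loop and no further edge. -/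
def IsReducedEnds [Fintype E] (s t : E → V) : Prop :=
  ∀ v, 3 ≤ degIn s t Finset.univ v ∨
    degIn s t Finset.univ v = 2 ∧ ∃ e, s e = v ∧ t e = v

omit [DecidableEq E] in
theorem IsReducedEnds.two_le [Fintype E] {s t : E → V} (h : IsReducedEnds s t) (v : V) :
    2 ≤ degIn s t Finset.univ v := by
  rcases h v with h | h <;> linarith [h]

/-- A loop uses up the whole degree of a vertex of degree `2`, leaving no room for a further edge.
-/
theorem IsReducedEnds.three_le [Fintype E] {s t : E → V} (h : IsReducedEnds s t) {v : V} {e : E}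
    (hl : s e ≠ t e) (he : IsEnd s t v e) : 3 ≤ degIn s t Finset.univ v := by
  rcases h v with h | ⟨-, f, h1, h2⟩
  · exact h
  · have hfl : s f = t f := h1.trans h2.symm
    have hef : e ≠ f := by rintro rfl; exact hl hfl
    have h3 : degIn s t {e, f} v ≤ degIn s t Finset.univ v :=
      Finset.sum_le_sum_of_subset_of_nonneg (Finset.subset_univ _)
        fun g _ _ => endCount_nonneg s t v g
    rw [degIn_pair v hef, endCount_of_ne hl he, endCount_of_loop hfl (Or.inl h1)] at h3
    linarith

/-- Two edges share an end. -/
def ShareEnd (s t : E → V) (e f : E) : Prop := ∃ v, IsEnd s t v e ∧ IsEnd s t v f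

variable [Fintype V] [Fintype E]

/-- At a vertex of degree `d` where `e` and `f` have `a` and `b` ends, the factors are `(1 - d)(1 -
d + a + b)` and `(1 - d + a)(1 - d + b)`; the second exceeds the first by `a b`. Without a common
end all factors agree. With one, reducedness controls signs and zeros, so that the difference
survives in the product. -/
theorem defect_mul_eq_iff {s t : E → V} (h : IsReducedEnds s t) {e f : E} (hef : e ≠ f) :
    defect s t Finset.univ * defect s t ((Finset.univ.erase e).erase f) =
        defect s t (Finset.univ.erase e) * defect s t (Finset.univ.erase f) ↔
      ¬ ShareEnd s t e f := by
  -- If `e` is a loop at `v`, the factors can differ only at `v`; the common factors elsewhere are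
  -- nonzero, so they cancel.
  have key : ∀ {e f : E}, e ≠ f → s e = t e → ShareEnd s t e f →
      ∏ v, (1 - degIn s t Finset.univ v) *
        (1 - degIn s t Finset.univ v + endCount s t v e + endCount s t v f) ≠
      ∏ v, (1 - degIn s t Finset.univ v + endCount s t v e) *
        (1 - degIn s t Finset.univ v + endCount s t v f) := by
    rintro e f hef hl ⟨v, hve, hvf⟩
    rw [← Finset.mul_prod_erase _ _ (Finset.mem_univ v), ← Finset.mul_prod_erase _ _
      (Finset.mem_univ v)]
    have hz : ∀ w ∈ Finset.univ.erase v, endCount s t w e = 0 := by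
      intro w hw
      refine endCount_eq_zero fun hwe => Finset.ne_of_mem_erase hw ?_
      rcases hve with rfl | rfl <;> rcases hwe with rfl | rfl <;> simp [hl]
    have h1 : ∏ w ∈ Finset.univ.erase v, (1 - degIn s t Finset.univ w) *
        (1 - degIn s t Finset.univ w + endCount s t w e + endCount s t w f) =
      ∏ w ∈ Finset.univ.erase v, (1 - degIn s t Finset.univ w + endCount s t w e) *
        (1 - degIn s t Finset.univ w + endCount s t w f) := by
      refine Finset.prod_congr rfl fun w hw => ?_
      rw [hz w hw]; ring
    rw [h1]
    intro h2
    have h3 := mul_right_cancel₀ (Finset.prod_ne_zero_iff.2 fun w hw => ?_) h2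
    · have h4 := endCount_pos hve
      have h5 := endCount_pos hvf
      nlinarith
    · rw [hz w hw, add_zero]
      have h4 := h.two_le w
      refine mul_ne_zero (by linarith) fun h5 => ?_
      -- An edge `f` meeting both `v` and `w ≠ v` is no loop, so `w` has degree at least `3` and
      -- loses only one end.
      by_cases hwf : IsEnd s t w f
      · by_cases hlf : s f = t f
        · refine Finset.ne_of_mem_erase hw ?_
          rcases hvf with rfl | rfl <;> rcases hwf with rfl | rfl <;> simp [hlf]
        · have := h.three_le hlf hwf
          rw [endCount_of_ne hlf hwf] at h5
          linarith
      · rw [endCount_eq_zero hwf] at h5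
        linarith
  have e1 : defect s t Finset.univ * defect s t ((Finset.univ.erase e).erase f) =
      ∏ v, (1 - degIn s t Finset.univ v) *
        (1 - degIn s t Finset.univ v + endCount s t v e + endCount s t v f) := by
    rw [defect, defect, ← Finset.prod_mul_distrib]
    refine Finset.prod_congr rfl fun v _ => ?_
    rw [degIn_erase v (by simp [hef.symm]), degIn_erase v (Finset.mem_univ e)]
    ring
  have e2 : defect s t (Finset.univ.erase e) * defect s t (Finset.univ.erase f) =
      ∏ v, (1 - degIn s t Finset.univ v + endCount s t v e) *
        (1 - degIn s t Finset.univ v + endCount s t v f) := by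
    rw [defect, defect, ← Finset.prod_mul_distrib]
    refine Finset.prod_congr rfl fun v _ => ?_
    rw [degIn_erase v (Finset.mem_univ f), degIn_erase v (Finset.mem_univ e)]
    ring
  rw [e1, e2]
  constructor
  · intro heq hadj
    by_cases hle : s e = t e
    · exact key hef hle hadj heq
    by_cases hlf : s f = t f
    · refine key hef.symm hlf ?_ ?_
      · obtain ⟨v, h1, h2⟩ := hadj
        exact ⟨v, h2, h1⟩
      · convert heq using 1 <;> refine Finset.prod_congr rfl fun v _ => by ring
    obtain ⟨v, hve, hvf⟩ := hadj
    have hone : ∀ {e : E}, s e ≠ t e → ∀ w,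
        (endCount s t w e = 0 ∨ endCount s t w e = 1 ∧ 3 ≤ degIn s t Finset.univ w) := by
      intro e hl w
      by_cases hw : IsEnd s t w e
      · exact Or.inr ⟨endCount_of_ne hl hw, h.three_le hl hw⟩
      · exact Or.inl (endCount_eq_zero hw)
    -- For two non-loops, any vertex that loses an end has degree at least `3`. So the right-hand
    -- factors are positive and the left-hand ones nonnegative and no larger, strictly smaller at
    -- the shared vertex.
    have hpos : ∀ w, 0 < (1 - degIn s t Finset.univ w + endCount s t w e) *
        (1 - degIn s t Finset.univ w + endCount s t w f) := by
      intro w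
      have := h.two_le w
      refine mul_pos_of_neg_of_neg ?_ ?_
      · rcases hone hle w with h1 | h1 <;> linarith
      · rcases hone hlf w with h1 | h1 <;> linarith
    have hlow : ∀ w, 0 ≤ (1 - degIn s t Finset.univ w) *
        (1 - degIn s t Finset.univ w + endCount s t w e + endCount s t w f) := by
      intro w
      have := h.two_le w
      refine mul_nonneg_of_nonpos_of_nonpos (by linarith) ?_
      rcases hone hle w with h1 | h1 <;> rcases hone hlf w with h2 | h2 <;> linarith
    have hle' : ∀ w, (1 - degIn s t Finset.univ w) *
        (1 - degIn s t Finset.univ w + endCount s t w e + endCount s t w f) ≤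
        (1 - degIn s t Finset.univ w + endCount s t w e) *
        (1 - degIn s t Finset.univ w + endCount s t w f) := by
      intro w
      have := mul_nonneg (endCount_nonneg s t w e) (endCount_nonneg s t w f)
      nlinarith
    refine absurd heq (ne_of_lt ?_)
    rw [← Finset.mul_prod_erase _ _ (Finset.mem_univ v), ← Finset.mul_prod_erase _ _
      (Finset.mem_univ v)]
    refine lt_of_le_of_lt (mul_le_mul_of_nonneg_left
      (Finset.prod_le_prod (fun w _ => hlow w) fun w _ => hle' w) (hlow v)) ?_
    refine mul_lt_mul_of_pos_right ?_ (Finset.prod_pos fun w _ => hpos w)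
    have h1 := endCount_of_ne hle hve
    have h2 := endCount_of_ne hlf hvf
    rw [h1, h2]
    nlinarith
  · intro hadj
    refine Finset.prod_congr rfl fun v _ => ?_
    have : endCount s t v e * endCount s t v f = 0 := by
      by_cases hve : IsEnd s t v e
      · have hvf : ¬ IsEnd s t v f := fun hvf => hadj ⟨v, hve, hvf⟩
        rw [endCount_eq_zero hvf, mul_zero]
      · rw [endCount_eq_zero hve, zero_mul]
    linear_combination -this

end EndsLemmas

/-! ### Recovering the stars of vertices, in the manner of Whitney. -/

section Reconstruction

variable {V V' E : Type*} [DecidableEq V] [DecidableEq V'] [DecidableEq E]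

omit [DecidableEq V] [DecidableEq E] in
theorem exists_other_end {s t : E → V} {e : E} {v : V} (hl : s e ≠ t e) (h : IsEnd s t v e) :
    ∃ x, x ≠ v ∧ ∀ z, IsEnd s t z e ↔ z = v ∨ z = x := by
  rcases h with rfl | rfl
  · exact ⟨t e, hl.symm, fun z => by simp [IsEnd, eq_comm]⟩
  · exact ⟨s e, hl, fun z => by simp [IsEnd, eq_comm, or_comm]⟩

omit [DecidableEq V] [DecidableEq E] in
theorem loop_isEnd_iff {s t : E → V} {e : E} {v : V} (hl : s e = t e) (h : IsEnd s t v e) (z : V) :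
    IsEnd s t z e ↔ z = v := by
  rcases h with rfl | rfl <;> simp [IsEnd, hl, eq_comm]

omit [DecidableEq E] in
theorem endCount_of_ne_eq_ite {s t : E → V} {e : E} (hl : s e ≠ t e) (v : V)
    [Decidable (IsEnd s t v e)] : endCount s t v e = if IsEnd s t v e then 1 else 0 := by
  split_ifs with h
  · exact endCount_of_ne hl h
  · exact endCount_eq_zero h

/-- Two multigraphs with the same edges have the same loops, the same pairs of edges that share an
end, and the same sets of edges that cover no vertex exactly once. -/
structure SameShape (s t : E → V) (s' t' : E → V') : Prop where
  loop_iff : ∀ e, s e = t e ↔ s' e = t' e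
  share_iff : ∀ e f, ShareEnd s t e f ↔ ShareEnd s' t' e f
  cover_iff : ∀ R : Finset E, (∀ v, degIn s t R v ≠ 1) ↔ ∀ v, degIn s' t' R v ≠ 1

variable {s t : E → V} {s' t' : E → V'}

omit [DecidableEq E] in
theorem SameShape.symm (h : SameShape s t s' t') : SameShape s' t' s t :=
  ⟨fun e => (h.loop_iff e).symm, fun e f => (h.share_iff e f).symm, fun R => (h.cover_iff R).symm⟩

omit [DecidableEq E] in
theorem loop_iff_degIn (e : E) : s e = t e ↔ ∀ v, degIn s t {e} v ≠ 1 := by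
  simp only [degIn, Finset.sum_singleton]
  constructor
  · intro hl v
    by_cases hv : IsEnd s t v e
    · rw [endCount_of_loop hl hv]; norm_num
    · rw [endCount_eq_zero hv]; norm_num
  · intro h
    by_contra hl
    exact h (s e) (endCount_of_ne hl (Or.inl rfl))

/-- The vertices covered once by two non-loops form the symmetric difference of their end sets. -/
theorem parallel_iff_degIn {e f : E} (hef : e ≠ f) (he : s e ≠ t e) (hf : s f ≠ t f) :
    (∀ v, IsEnd s t v e ↔ IsEnd s t v f) ↔ ∀ v, degIn s t {e, f} v ≠ 1 := by
  classical
  refine forall_congr' fun v => ?_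
  rw [degIn_pair v hef, endCount_of_ne_eq_ite he, endCount_of_ne_eq_ite hf]
  by_cases h1 : IsEnd s t v e <;> by_cases h2 : IsEnd s t v f <;> simp [h1, h2]

theorem sameShape_of_defect_eq [Fintype V] [Fintype V'] [Fintype E] (h : IsReducedEnds s t)
    (h' : IsReducedEnds s' t') (hd : ∀ R, defect s t R = defect s' t' R) :
    SameShape s t s' t' := by
  have hc : ∀ R : Finset E, (∀ v, degIn s t R v ≠ 1) ↔ ∀ v, degIn s' t' R v ≠ 1 := by
    intro R
    rw [← defect_ne_zero_iff, ← defect_ne_zero_iff, hd]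
  refine ⟨fun e => ?_, fun e f => ?_, hc⟩
  · rw [loop_iff_degIn, loop_iff_degIn, hc]
  · by_cases hef : e = f
    · subst hef
      exact ⟨fun _ => ⟨s' e, Or.inl rfl, Or.inl rfl⟩, fun _ => ⟨s e, Or.inl rfl, Or.inl rfl⟩⟩
    · rw [← not_iff_not, ← defect_mul_eq_iff h hef, ← defect_mul_eq_iff h' hef, hd, hd, hd, hd]

namespace SameShape

theorem parallel_iff (h : SameShape s t s' t') {e f : E} (he : s e ≠ t e) (hf : s f ≠ t f) :
    (∀ v, IsEnd s t v e ↔ IsEnd s t v f) ↔ ∀ v, IsEnd s' t' v e ↔ IsEnd s' t' v f := by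
  by_cases hef : e = f
  · subst hef; simp
  · rw [parallel_iff_degIn hef he hf, h.cover_iff, parallel_iff_degIn hef]
    · rwa [Ne, ← h.loop_iff]
    · rwa [Ne, ← h.loop_iff]

omit [DecidableEq E] in
theorem loop_star (h : SameShape s t s' t') {e : E} {v : V} {w : V'} (hl : s e = t e)
    (hv : IsEnd s t v e) (hw : IsEnd s' t' w e) (g : E) (hg : IsEnd s t v g) :
    IsEnd s' t' w g := by
  obtain ⟨z, hz1, hz2⟩ := (h.share_iff e g).1 ⟨v, hv, hg⟩
  rw [loop_isEnd_iff ((h.loop_iff e).1 hl) hw] at hz1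
  rwa [← hz1]

/-- If `g` missed `w`, it would join `x'` to `y'` and close a triangle with `e` and `f`, covering no
vertex exactly once. In the first graph `g` passes through `v`, so it cannot reach both `x` and `y`,
and one of them is covered once. -/
theorem star_of_corner (h : SameShape s t s' t') {e f : E} {v x y : V} {w x' y' : V'}
    (he : ∀ z, IsEnd s t z e ↔ z = v ∨ z = x) (hf : ∀ z, IsEnd s t z f ↔ z = v ∨ z = y)
    (hvx : x ≠ v) (hvy : y ≠ v) (hxy : x ≠ y)
    (he' : ∀ z, IsEnd s' t' z e ↔ z = w ∨ z = x') (hf' : ∀ z, IsEnd s' t' z f ↔ z = w ∨ z = y')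
    (hwx : x' ≠ w) (hwy : y' ≠ w) (hxy' : x' ≠ y') (g : E) (hg : IsEnd s t v g) :
    IsEnd s' t' w g := by
  classical
  by_contra hwg
  have hge := (h.share_iff e g).1 ⟨v, (he v).2 (Or.inl rfl), hg⟩
  have hgf := (h.share_iff f g).1 ⟨v, (hf v).2 (Or.inl rfl), hg⟩
  have hx'g : IsEnd s' t' x' g := by
    obtain ⟨z, hz1, hz2⟩ := hge
    rcases (he' z).1 hz1 with rfl | rfl
    · exact absurd hz2 hwg
    · exact hz2
  have hy'g : IsEnd s' t' y' g := by
    obtain ⟨z, hz1, hz2⟩ := hgf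
    rcases (hf' z).1 hz1 with rfl | rfl
    · exact absurd hz2 hwg
    · exact hz2
  have hgl' : s' g ≠ t' g := fun hl => hxy' ((loop_isEnd_iff hl hy'g x').1 hx'g)
  have hgl : s g ≠ t g := by rwa [Ne, h.loop_iff]
  have hel' : s' e ≠ t' e := fun hl =>
    hwx ((loop_isEnd_iff hl ((he' w).2 (Or.inl rfl)) x').1 ((he' x').2 (Or.inr rfl)))
  have hfl' : s' f ≠ t' f := fun hl =>
    hwy ((loop_isEnd_iff hl ((hf' w).2 (Or.inl rfl)) y').1 ((hf' y').2 (Or.inr rfl)))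
  have hel : s e ≠ t e := by rwa [Ne, h.loop_iff]
  have hfl : s f ≠ t f := by rwa [Ne, h.loop_iff]
  have hef : e ≠ f := by
    rintro rfl
    rcases (hf' x').1 ((he' x').2 (Or.inr rfl)) with h1 | h1
    · exact hwx h1
    · exact hxy' h1
  have heg : e ≠ g := by
    rintro rfl
    exact hwg ((he' w).2 (Or.inl rfl))
  have hfg : f ≠ g := by
    rintro rfl
    exact hwg ((hf' w).2 (Or.inl rfl))
  have hends' : ∀ z, IsEnd s' t' z g ↔ z = x' ∨ z = y' := by
    obtain ⟨y'', h1, h2⟩ := exists_other_end hgl' hx'g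
    rcases (h2 y').1 hy'g with h3 | h3
    · exact absurd h3.symm hxy'
    · rwa [h3]
  have hcov : ∀ z, degIn s' t' {e, f, g} z ≠ 1 := by
    intro z
    rw [degIn_triple z hef heg hfg, endCount_of_ne_eq_ite hel', endCount_of_ne_eq_ite hfl',
      endCount_of_ne_eq_ite hgl']
    simp only [he', hf', hends']
    by_cases h1 : z = w
    · subst h1; simp [hwx.symm, hwy.symm]
    · by_cases h2 : z = x'
      · subst h2; simp [h1, hxy']
      · by_cases h3 : z = y'
        · subst h3; simp [h1, h2]
        · simp [h1, h2, h3]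
  obtain ⟨u, hu1, hu2⟩ := exists_other_end hgl hg
  rw [← h.cover_iff] at hcov
  have hx := hcov x
  have hy := hcov y
  rw [degIn_triple _ hef heg hfg, endCount_of_ne_eq_ite hel, endCount_of_ne_eq_ite hfl,
    endCount_of_ne_eq_ite hgl] at hx hy
  simp only [he, hf, hu2] at hx hy
  simp only [hvx, hxy, hvy, hxy.symm, or_true, or_false, false_or, if_true, if_false] at hx hy
  by_cases h1 : x = u
  · have h2 : y ≠ u := fun h2 => hxy (h1.trans h2.symm)
    simp [h2] at hy
  · simp [h1] at hx

/-- Here the star of `v` is a bundle parallel to `e`, and the candidates for its image are the two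
ends `w`, `w'` of `e`. If both fail, each has an extra edge, `f` and `g`. In the first graph these
meet `e` only at `v'`, so they share an end; in the second they must then close a triangle with `e`.
But in the first graph `e, f, g` cover `v` exactly once. -/
theorem exists_same_star_of_parallel (h : SameShape s t s' t') {e : E} {v : V}
    (hl : s e ≠ t e) (hve : IsEnd s t v e)
    (hpar : ∀ g, IsEnd s t v g → ∀ z, IsEnd s t z e ↔ IsEnd s t z g)
    (hnl : ∀ g, IsEnd s t v g → s g ≠ t g) :
    ∃ w, ∀ g, IsEnd s t v g ↔ IsEnd s' t' w g := by
  classical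
  obtain ⟨v', hv', hends⟩ := exists_other_end hl hve
  have hl' : s' e ≠ t' e := by rwa [Ne, ← h.loop_iff]
  obtain ⟨w', hw', hends'⟩ := exists_other_end hl' (Or.inl rfl)
  set w := s' e with hw
  by_contra hcon
  push Not at hcon
  have hfwd : ∀ g, IsEnd s t v g → ∀ z, IsEnd s' t' z e ↔ IsEnd s' t' z g := fun g hg =>
    (h.parallel_iff hl (hnl g hg)).1 (hpar g hg)
  have hbad : ∀ z, IsEnd s' t' z e → ∃ g, IsEnd s' t' z g ∧ ¬ IsEnd s t v g := by
    intro z hz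
    obtain ⟨g, hg⟩ := hcon z
    rcases hg with ⟨h1, h2⟩ | ⟨h1, h2⟩
    · exact absurd ((hfwd g h1 z).1 hz) h2
    · exact ⟨g, h2, h1⟩
  have hshare : ∀ z g, IsEnd s' t' z e → IsEnd s' t' z g → ¬ IsEnd s t v g → IsEnd s t v' g := by
    intro z g hz hg hvg
    obtain ⟨u, hu1, hu2⟩ := (h.share_iff e g).2 ⟨z, hz, hg⟩
    rcases (hends u).1 hu1 with rfl | rfl
    · exact absurd hu2 hvg
    · exact hu2
  have hwe : IsEnd s' t' w e := (hends' w).2 (Or.inl rfl)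
  have hwe' : IsEnd s' t' w' e := (hends' w').2 (Or.inr rfl)
  obtain ⟨f, hf1, hf2⟩ := hbad w hwe
  obtain ⟨g, hg1, hg2⟩ := hbad w' hwe'
  have hf3 := hshare w f hwe hf1 hf2
  have hg3 := hshare w' g hwe' hg1 hg2
  -- An edge joining `w` and `w'` is parallel to `e` in the second graph, hence in the first, where
  -- it would meet `v`.
  have hnotpar : ∀ k, ¬ IsEnd s t v k → IsEnd s' t' w k → IsEnd s' t' w' k → False := by
    intro k hk h1 h2
    have hkl : s' k ≠ t' k := fun hkl => hw' ((loop_isEnd_iff hkl h1 w').1 h2)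
    have hkl2 : s k ≠ t k := by rwa [Ne, h.loop_iff]
    obtain ⟨u, hu1, hu2⟩ := exists_other_end hkl h1
    have hu : w' = u := by
      rcases (hu2 w').1 h2 with h3 | h3
      · exact absurd h3 hw'
      · exact h3
    subst hu
    have := (h.parallel_iff hl hkl2).2 fun z => by rw [hends', hu2]
    exact hk ((this v).1 hve)
  have hfl' : s' f ≠ t' f := by
    intro hfl
    obtain ⟨z, hz1, hz2⟩ := (h.share_iff f g).1 ⟨v', hf3, hg3⟩
    rw [loop_isEnd_iff hfl hf1] at hz1
    subst hz1
    exact hnotpar g hg2 hz2 hg1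
  have hgl' : s' g ≠ t' g := by
    intro hgl
    obtain ⟨z, hz1, hz2⟩ := (h.share_iff f g).1 ⟨v', hf3, hg3⟩
    rw [loop_isEnd_iff hgl hg1] at hz2
    subst hz2
    exact hnotpar f hf2 hf1 hz1
  obtain ⟨x, hx, hfends⟩ := exists_other_end hfl' hf1
  obtain ⟨y, hy, hgends⟩ := exists_other_end hgl' hg1
  have hxw' : x ≠ w' := by
    rintro rfl
    exact hnotpar f hf2 hf1 ((hfends x).2 (Or.inr rfl))
  have hyw : y ≠ w := by
    rintro rfl
    exact hnotpar g hg2 ((hgends _).2 (Or.inr rfl)) hg1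
  have hxy : x = y := by
    obtain ⟨z, hz1, hz2⟩ := (h.share_iff f g).1 ⟨v', hf3, hg3⟩
    rcases (hfends z).1 hz1 with rfl | rfl
    · exact (hnotpar g hg2 hz2 hg1).elim
    · rcases (hgends z).1 hz2 with h1 | h1
      · exact absurd h1 hxw'
      · exact h1
  subst hxy
  have hef : e ≠ f := by rintro rfl; exact hf2 hve
  have heg : e ≠ g := by rintro rfl; exact hg2 hve
  have hfg : f ≠ g := by rintro rfl; exact hnotpar f hf2 hf1 hg1
  have hcov : ∀ z, degIn s' t' {e, f, g} z ≠ 1 := by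
    intro z
    rw [degIn_triple z hef heg hfg, endCount_of_ne_eq_ite hl', endCount_of_ne_eq_ite hfl',
      endCount_of_ne_eq_ite hgl']
    simp only [hends', hfends, hgends]
    by_cases h1 : z = w
    · simp [h1, hyw.symm, hw'.symm]
    · by_cases h2 : z = w'
      · simp [h2, hw', hxw'.symm]
      · by_cases h3 : z = x
        · simp [h3, hx, hxw']
        · simp [h1, h2, h3]
  rw [← h.cover_iff] at hcov
  refine hcov v ?_
  rw [degIn_triple v hef heg hfg, endCount_of_ne hl hve, endCount_eq_zero hf2,
    endCount_eq_zero hg2]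
  norm_num

/-- Three cases: a loop at `v`; all edges at `v` parallel; or two non-parallel edges at `v`, whose
common end in the second graph is the image of `v`. -/
theorem exists_same_star (h : SameShape s t s' t') {v : V} (hv : ∃ e, IsEnd s t v e) :
    ∃ w, ∀ g, IsEnd s t v g ↔ IsEnd s' t' w g := by
  by_cases hloop : ∃ e, IsEnd s t v e ∧ s e = t e
  · obtain ⟨e, he, hl⟩ := hloop
    have hw : IsEnd s' t' (s' e) e := Or.inl rfl
    exact ⟨s' e, fun g => ⟨h.loop_star hl he hw g,
      h.symm.loop_star ((h.loop_iff e).1 hl) hw he g⟩⟩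
  push Not at hloop
  obtain ⟨e, he⟩ := hv
  by_cases hpar : ∀ g, IsEnd s t v g → ∀ z, IsEnd s t z e ↔ IsEnd s t z g
  · exact h.exists_same_star_of_parallel (hloop e he) he hpar hloop
  · push Not at hpar
    obtain ⟨f, hf, hnp⟩ := hpar
    have hel := hloop e he
    have hfl := hloop f hf
    have hel' : s' e ≠ t' e := by rwa [Ne, ← h.loop_iff]
    have hfl' : s' f ≠ t' f := by rwa [Ne, ← h.loop_iff]
    obtain ⟨x, hx, hex⟩ := exists_other_end hel he
    obtain ⟨y, hy, hfy⟩ := exists_other_end hfl hf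
    have hnp2 : ¬ ∀ z, IsEnd s t z e ↔ IsEnd s t z f := by
      intro hall
      obtain ⟨z, hz⟩ := hnp
      rcases hz with ⟨h1, h2⟩ | ⟨h1, h2⟩
      · exact h2 ((hall z).1 h1)
      · exact h1 ((hall z).2 h2)
    have hxy : x ≠ y := by
      rintro rfl
      exact hnp2 fun z => by rw [hex, hfy]
    obtain ⟨w, hwe, hwf⟩ := (h.share_iff e f).1 ⟨v, he, hf⟩
    obtain ⟨x', hx', hex'⟩ := exists_other_end hel' hwe
    obtain ⟨y', hy', hfy'⟩ := exists_other_end hfl' hwf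
    have hxy' : x' ≠ y' := by
      rintro rfl
      exact hnp2 ((h.parallel_iff hel hfl).2 fun z => by rw [hex', hfy'])
    exact ⟨w, fun g => ⟨h.star_of_corner hex hfy hx hy hxy hex' hfy' hx' hy' hxy' g,
      h.symm.star_of_corner hex' hfy' hx' hy' hxy' hex hfy hx hy hxy g⟩⟩

end SameShape

end Reconstruction

/-! ### From equal stars to a bijection of vertices. -/

section VertexBijection

variable {V V' E : Type*} [DecidableEq V] [DecidableEq V'] [DecidableEq E]
  {s t : E → V} {s' t' : E → V'}

/-- The edges at a vertex. -/
def edgesAt (s t : E → V) (v : V) : Set E := {e | IsEnd s t v e}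

/-- Two vertices with the same star are the two ends of a bundle of parallel edges forming a
component. Shape preserves this, so the other end of the bundle is the twin. -/
theorem SameShape.exists_twin (h : SameShape s t s' t') {v₁ v₂ : V} {w : V'} (hne : v₁ ≠ v₂)
    (h12 : edgesAt s t v₂ = edgesAt s t v₁) (hw : edgesAt s' t' w = edgesAt s t v₁)
    (hv : ∃ e, IsEnd s t v₁ e) : ∃ w₂ ≠ w, edgesAt s' t' w₂ = edgesAt s t v₁ := by
  have h2 : ∀ g, IsEnd s t v₂ g ↔ IsEnd s t v₁ g := fun g => Set.ext_iff.1 h12 g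
  have hw' : ∀ g, IsEnd s' t' w g ↔ IsEnd s t v₁ g := fun g => Set.ext_iff.1 hw g
  have hnl : ∀ g, IsEnd s t v₁ g → s g ≠ t g := fun g hg hl =>
    hne ((loop_isEnd_iff hl ((h2 g).2 hg) v₁).1 hg)
  have hends : ∀ g, IsEnd s t v₁ g → ∀ z, IsEnd s t z g ↔ z = v₁ ∨ z = v₂ := by
    intro g hg
    obtain ⟨x, hx, hgx⟩ := exists_other_end (hnl g hg) hg
    rcases (hgx v₂).1 ((h2 g).2 hg) with h3 | h3
    · exact absurd h3.symm hne
    · rwa [h3]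
  obtain ⟨e, he⟩ := hv
  have hnl' : ∀ g, IsEnd s t v₁ g → s' g ≠ t' g := fun g hg => by
    rw [Ne, ← h.loop_iff]; exact hnl g hg
  obtain ⟨w₂, hw₂, hew₂⟩ := exists_other_end (hnl' e he) ((hw' e).2 he)
  refine ⟨w₂, hw₂, Set.ext fun g => ⟨fun hg => ?_, fun hg => ?_⟩⟩
  · obtain ⟨z, hz1, hz2⟩ := (h.share_iff e g).2 ⟨w₂, (hew₂ w₂).2 (Or.inr rfl), hg⟩
    rcases (hends e he z).1 hz1 with rfl | rfl
    · exact hz2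
    · exact (h2 g).1 hz2
  · have hpar := (h.parallel_iff (hnl e he) (hnl g hg)).1 fun z => by
      rw [hends e he, hends g hg]
    exact (hpar w₂).1 ((hew₂ w₂).2 (Or.inr rfl))

/-- All vertices with a given star are ends of one chosen edge, so there are at most two; a second
one is matched by a twin. -/
theorem SameShape.ncard_fiber_le [Finite V] [Finite V'] (h : SameShape s t s' t')
    (hv : ∀ v, ∃ e, IsEnd s t v e) (S : Set E) :
    {v | edgesAt s t v = S}.ncard ≤ {w | edgesAt s' t' w = S}.ncard := by
  rcases Set.eq_empty_or_nonempty {v | edgesAt s t v = S} with h0 | ⟨v, hvS⟩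
  · rw [h0, Set.ncard_empty]; exact Nat.zero_le _
  have hvS' : edgesAt s t v = S := hvS
  subst hvS'
  obtain ⟨w, hw⟩ := h.exists_same_star (hv v)
  have hwS : edgesAt s' t' w = edgesAt s t v := Set.ext fun g => (hw g).symm
  by_cases h1 : {x | edgesAt s t x = edgesAt s t v}.ncard ≤ 1
  · exact h1.trans ((Set.ncard_pos (Set.toFinite _)).2 ⟨w, hwS⟩)
  · have : ∃ v₂, v ≠ v₂ ∧ edgesAt s t v₂ = edgesAt s t v := by
      obtain ⟨v₂, h2, h3⟩ := Set.exists_ne_of_one_lt_ncard (not_le.1 h1) v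
      exact ⟨v₂, h3.symm, h2⟩
    obtain ⟨v₂, hne, h2⟩ := this
    obtain ⟨w₂, hw₂, hw₂S⟩ := h.exists_twin hne h2 hwS (hv v)
    obtain ⟨e, he⟩ := hv v
    calc {x | edgesAt s t x = edgesAt s t v}.ncard ≤ ({s e, t e} : Set V).ncard := by
          refine Set.ncard_le_ncard (fun x hx => ?_) (Set.toFinite _)
          have hxe : e ∈ edgesAt s t x := by
            have : edgesAt s t x = edgesAt s t v := hx
            rw [this]; exact he
          rcases hxe with hx | hx
          · exact Or.inl hx.symm
          · exact Or.inr hx.symm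
      _ ≤ 2 := (Set.ncard_insert_le _ _).trans (by simp)
      _ = ({w, w₂} : Set V').ncard := (Set.ncard_pair hw₂.symm).symm
      _ ≤ _ := by
          refine Set.ncard_le_ncard (fun x hx => ?_) (Set.toFinite _)
          rcases hx with rfl | rfl
          · exact hwS
          · exact hw₂S

/-- Multigraphs of the same shape without isolated vertices are isomorphic, with the same edges. -/
theorem SameShape.exists_equiv [Finite V] [Finite V'] (h : SameShape s t s' t')
    (hv : ∀ v, ∃ e, IsEnd s t v e) (hv' : ∀ w, ∃ e, IsEnd s' t' w e) :
    ∃ φ : V ≃ V', ∀ e, s(φ (s e), φ (t e)) = s(s' e, t' e) := by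
  have hcard : ∀ S : Set E, Nonempty ({v // edgesAt s t v = S} ≃ {w // edgesAt s' t' w = S}) := by
    intro S
    exact Finite.card_eq.1 (le_antisymm (h.ncard_fiber_le hv S) (h.symm.ncard_fiber_le hv' S))
  let ψ := fun S => (hcard S).some
  refine ⟨Equiv.ofFiberEquiv ψ, fun e => ?_⟩
  set φ : V ≃ V' := Equiv.ofFiberEquiv ψ with hφ
  have hmap : ∀ v, edgesAt s' t' (φ v) = edgesAt s t v := fun v => Equiv.ofFiberEquiv_map ψ v
  have hend : ∀ v, IsEnd s' t' (φ v) e ↔ IsEnd s t v e := fun v => Set.ext_iff.1 (hmap v) e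
  by_cases hl : s e = t e
  · have hl' := (h.loop_iff e).1 hl
    have h1 := (hend (s e)).2 (Or.inl rfl)
    rw [loop_isEnd_iff hl' (Or.inl rfl)] at h1
    rw [← hl, ← hl', h1]
  · have h1 := (hend (s e)).2 (Or.inl rfl)
    have h2 := (hend (t e)).2 (Or.inr rfl)
    have hne : φ (s e) ≠ φ (t e) := fun h => hl (φ.injective h)
    rcases h1 with h1 | h1 <;> rcases h2 with h2 | h2
    · exact absurd (h1.symm.trans h2) hne
    · rw [h1, h2]
    · rw [h1, h2]; exact Sym2.eq_swap
    · exact absurd (h1.symm.trans h2) hne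

end VertexBijection

/-! ### Reduced multigraphs: reconstruction and separation of edges. -/

section ReducedTheorem

variable {V V' E : Type*} [DecidableEq V] [DecidableEq V'] [DecidableEq E]
  [Fintype V] [Fintype V'] [Fintype E] {s t : E → V} {s' t' : E → V'}

omit [DecidableEq E] [Fintype V] in
theorem IsReducedEnds.exists_isEnd (h : IsReducedEnds s t) (v : V) : ∃ e, IsEnd s t v e := by
  by_contra hcon
  push Not at hcon
  have h1 := h.two_le v
  rw [degIn, Finset.sum_eq_zero fun e _ => endCount_eq_zero (hcon e)] at h1
  norm_num at h1

/-- A reduced multigraph is determined by its defects. -/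
theorem IsReducedEnds.exists_equiv (h : IsReducedEnds s t) (h' : IsReducedEnds s' t')
    (hd : ∀ R, defect s t R = defect s' t' R) :
    ∃ φ : V ≃ V', ∀ e, s(φ (s e), φ (t e)) = s(s' e, t' e) :=
  (sameShape_of_defect_eq h h' hd).exists_equiv h.exists_isEnd h'.exists_isEnd

/-- In a reduced multigraph, any two edges are separated by a set of edges of nonzero defect. -/
theorem IsReducedEnds.exists_separating (h : IsReducedEnds s t) {e f : E} (hef : e ≠ f) :
    ∃ R, defect s t R ≠ 0 ∧ ¬ (e ∈ R ↔ f ∈ R) := by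
  simp only [defect_ne_zero_iff]
  -- Deleting an edge creates a vertex of degree `1` only when the edge is a loop at a vertex of
  -- degree `3`. If deleting `e` fails and deleting `f` fails too, the loop `e` on its own separates
  -- them.
  have hdel : ∀ e, (∀ v, degIn s t (Finset.univ.erase e) v ≠ 1) ∨
      ∃ v, s e = v ∧ t e = v ∧ degIn s t Finset.univ v = 3 := by
    intro e
    by_cases hl : s e = t e
    · by_cases h3 : degIn s t Finset.univ (s e) = 3
      · exact Or.inr ⟨s e, rfl, hl.symm, h3⟩
      · left
        intro v hv
        rw [degIn_erase v (Finset.mem_univ e)] at hv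
        by_cases hve : IsEnd s t v e
        · rw [endCount_of_loop hl hve] at hv
          rw [loop_isEnd_iff hl (Or.inl rfl)] at hve
          subst hve
          exact h3 (by linarith)
        · rw [endCount_eq_zero hve] at hv
          linarith [h.two_le v]
    · left
      intro v hv
      rw [degIn_erase v (Finset.mem_univ e)] at hv
      by_cases hve : IsEnd s t v e
      · rw [endCount_of_ne hl hve] at hv
        linarith [h.three_le hl hve]
      · rw [endCount_eq_zero hve] at hv
        linarith [h.two_le v]
  rcases hdel e with he | ⟨v, hs, ht, h3⟩
  · exact ⟨_, he, by simp [hef.symm]⟩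
  rcases hdel f with hf | ⟨w, hsw, htw, -⟩
  · exact ⟨_, hf, by simp [hef]⟩
  refine ⟨{e}, (loop_iff_degIn e).1 (hs.trans ht.symm), by simp [hef.symm]⟩

end ReducedTheorem

/-! ### Isomorphisms of multigraphs given by ends. -/

section EndsIso

/-- Two multigraphs given by the ends of their edges are isomorphic. -/
def EndsIso {V E V' E' : Type*} (s t : E → V) (s' t' : E' → V') : Prop :=
  ∃ (φ : V ≃ V') (ψ : E ≃ E'), ∀ e, s(φ (s e), φ (t e)) = s(s' (ψ e), t' (ψ e))

variable {V E V' E' V'' E'' : Type*} {s t : E → V} {s' t' : E' → V'} {s'' t'' : E'' → V''}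

theorem EndsIso.symm (h : EndsIso s t s' t') : EndsIso s' t' s t := by
  obtain ⟨φ, ψ, h⟩ := h
  refine ⟨φ.symm, ψ.symm, fun e => ?_⟩
  have := congrArg (Sym2.map φ.symm) (h (ψ.symm e))
  simpa using this.symm

theorem EndsIso.trans (h : EndsIso s t s' t') (h' : EndsIso s' t' s'' t'') :
    EndsIso s t s'' t'' := by
  obtain ⟨φ, ψ, h⟩ := h
  obtain ⟨φ', ψ', h'⟩ := h'
  refine ⟨φ.trans φ', ψ.trans ψ', fun e => ?_⟩
  have := congrArg (Sym2.map φ') (h e)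
  simp only [Sym2.map_mk] at this
  exact this.trans (h' (ψ e))

theorem endCount_eq_of_sym2_eq [DecidableEq V] [DecidableEq V'] {φ : V ≃ V'} {e : E} {e' : E'}
    (h : s(φ (s e), φ (t e)) = s(s' e', t' e')) (v : V) :
    endCount s t v e = endCount s' t' (φ v) e' := by
  rcases Sym2.eq_iff.1 h with ⟨h1, h2⟩ | ⟨h1, h2⟩
  · simp only [endCount, ← h1, ← h2, φ.injective.eq_iff]
  · simp only [endCount, ← h1, ← h2, φ.injective.eq_iff]
    rw [add_comm]

theorem degIn_map [DecidableEq V] [DecidableEq V'] {φ : V ≃ V'} {ψ : E ≃ E'}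
    (h : ∀ e, s(φ (s e), φ (t e)) = s(s' (ψ e), t' (ψ e))) (R : Finset E) (v : V) :
    degIn s t R v = degIn s' t' (R.map ψ.toEmbedding) (φ v) := by
  rw [degIn, degIn, Finset.sum_map]
  exact Finset.sum_congr rfl fun e _ => endCount_eq_of_sym2_eq (h e) v

theorem defect_map [Fintype V] [Fintype V'] [DecidableEq V] [DecidableEq V'] {φ : V ≃ V'}
    {ψ : E ≃ E'} (h : ∀ e, s(φ (s e), φ (t e)) = s(s' (ψ e), t' (ψ e))) (R : Finset E) :
    defect s t R = defect s' t' (R.map ψ.toEmbedding) := by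
  rw [defect, defect, ← φ.prod_comp]
  exact Finset.prod_congr rfl fun v _ => by rw [degIn_map h]

end EndsIso

/-! ### Subdivisions and their defects. -/

section Subdivision

variable {V E : Type*}

/-- Pairs of an edge `e` and a number below `k e`. -/
abbrev Slots (k : E → ℕ) : Type _ := {p : E × ℕ // p.2 < k p.1}

/-- Slots as a sum of finite intervals. -/
def slotsEquiv (k : E → ℕ) : Slots k ≃ Σ e, Fin (k e) where
  toFun p := ⟨p.1.1, p.1.2, p.2⟩
  invFun p := ⟨(p.1, p.2), p.2.2⟩
  left_inv _ := rfl
  right_inv _ := rfl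

instance [Fintype E] (k : E → ℕ) : Fintype (Slots k) := Fintype.ofEquiv _ (slotsEquiv k).symm

/-- The first ends in the subdivision in which `e` becomes a path with `n e` inner vertices. -/
def subFst (s : E → V) (n : E → ℕ) (p : Slots fun e => n e + 1) : V ⊕ Slots n :=
  -- Piece `i` of `e` runs from inner vertex `i - 1` to inner vertex `i`; piece `0` starts at `s e`
  -- and piece `n e` stops at `t e`.
  if h : p.1.2 = 0 then Sum.inl (s p.1.1)
  else Sum.inr ⟨(p.1.1, p.1.2 - 1), by have := p.2; simp only at this ⊢; omega⟩

/-- The second ends in the subdivision in which `e` becomes a path with `n e` inner vertices. -/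
def subSnd (t : E → V) (n : E → ℕ) (p : Slots fun e => n e + 1) : V ⊕ Slots n :=
  if h : p.1.2 < n p.1.1 then Sum.inr ⟨p.1, h⟩ else Sum.inl (t p.1.1)

variable {s t : E → V} {n : E → ℕ}

theorem subFst_eq_inl_iff {p : Slots fun e => n e + 1} {v : V} :
    subFst s n p = Sum.inl v ↔ p.1.2 = 0 ∧ s p.1.1 = v := by
  unfold subFst
  split_ifs with h <;> simp [h]

theorem subSnd_eq_inl_iff {p : Slots fun e => n e + 1} {v : V} :
    subSnd t n p = Sum.inl v ↔ p.1.2 = n p.1.1 ∧ t p.1.1 = v := by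
  unfold subSnd
  split_ifs with h
  · simp [h.ne]
  · have : p.1.2 = n p.1.1 := by have := p.2; simp only at this; omega
    simp [this]

theorem subFst_eq_inr_iff {p : Slots fun e => n e + 1} {q : Slots n} :
    subFst s n p = Sum.inr q ↔ p = ⟨(q.1.1, q.1.2 + 1), Nat.succ_lt_succ q.2⟩ := by
  obtain ⟨⟨e, i⟩, hi⟩ := p
  obtain ⟨⟨f, j⟩, hj⟩ := q
  unfold subFst
  split_ifs with h
  · simp only at h
    simp [h]
  · simp only at h
    simp only [Sum.inr.injEq, Subtype.mk.injEq, Prod.mk.injEq]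
    refine and_congr_right fun _ => ?_
    omega

theorem subSnd_eq_inr_iff {p : Slots fun e => n e + 1} {q : Slots n} :
    subSnd t n p = Sum.inr q ↔ p = ⟨q.1, q.2.trans (Nat.lt_succ_self _)⟩ := by
  obtain ⟨⟨e, i⟩, hi⟩ := p
  obtain ⟨⟨f, j⟩, hj⟩ := q
  unfold subSnd
  split_ifs with h
  · simp
  · simp only [Subtype.mk.injEq, Prod.mk.injEq, false_iff, not_and]
    rintro rfl rfl
    exact h hj

variable [DecidableEq V] [DecidableEq E]

theorem degIn_sub_inr (R : Finset (Slots fun e => n e + 1)) (q : Slots n) :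
    degIn (subFst s n) (subSnd t n) R (Sum.inr q) =
      (if (⟨(q.1.1, q.1.2 + 1), Nat.succ_lt_succ q.2⟩ : Slots fun e => n e + 1) ∈ R then 1 else 0) +
      if (⟨q.1, q.2.trans (Nat.lt_succ_self _)⟩ : Slots fun e => n e + 1) ∈ R then 1 else 0 := by
  simp only [degIn, endCount, subFst_eq_inr_iff, subSnd_eq_inr_iff, Finset.sum_add_distrib,
    Finset.sum_ite_eq']

/-- A set of nonzero defect contains all or none of the pieces of an edge. -/
theorem mem_iff_of_defect_sub_ne_zero [Fintype V] [Fintype E] {R : Finset (Slots fun e => n e + 1)}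
    (h : defect (subFst s n) (subSnd t n) R ≠ 0) {p q : Slots fun e => n e + 1}
    (hpq : p.1.1 = q.1.1) : p ∈ R ↔ q ∈ R := by
  rw [defect_ne_zero_iff] at h
  have key : ∀ (e : E) (i : ℕ) (hi : i < n e + 1),
      (⟨(e, i), hi⟩ : Slots fun e => n e + 1) ∈ R ↔
        (⟨(e, 0), Nat.succ_pos _⟩ : Slots fun e => n e + 1) ∈ R := by
    intro e i
    induction i with
    | zero => intro _; rfl
    | succ i ih =>
      intro hi
      rw [← ih (by omega)]
      -- Inner vertex `i` lies on pieces `i` and `i + 1` only, and its degree in `R` is not `1`.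
      have h1 := h (Sum.inr ⟨(e, i), by simpa using hi⟩)
      rw [degIn_sub_inr] at h1
      by_cases ha : (⟨(e, i + 1), hi⟩ : Slots fun e => n e + 1) ∈ R <;>
        by_cases hb : (⟨(e, i), by simp only; omega⟩ : Slots fun e => n e + 1) ∈ R <;>
        simp [ha, hb] at h1 ⊢
  obtain ⟨⟨e, i⟩, hi⟩ := p
  obtain ⟨⟨f, j⟩, hj⟩ := q
  simp only at hpq
  subst hpq
  rw [key, key _ j]

variable [Fintype E]

/-- All pieces of the edges in `R`. -/
def liftSlots (n : E → ℕ) (R : Finset E) : Finset (Slots fun e => n e + 1) :=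
  Finset.univ.filter fun p => p.1.1 ∈ R

theorem mem_liftSlots {R : Finset E} {p : Slots fun e => n e + 1} :
    p ∈ liftSlots n R ↔ p.1.1 ∈ R := by
  simp [liftSlots]

theorem degIn_lift_inr (R : Finset E) (q : Slots n) :
    degIn (subFst s n) (subSnd t n) (liftSlots n R) (Sum.inr q) = if q.1.1 ∈ R then 2 else 0 := by
  rw [degIn_sub_inr]
  simp only [mem_liftSlots]
  split_ifs <;> rfl

theorem degIn_lift_inl (R : Finset E) (v : V) :
    degIn (subFst s n) (subSnd t n) (liftSlots n R) (Sum.inl v) = degIn s t R v := by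
  simp only [degIn, endCount, Finset.sum_add_distrib, subFst_eq_inl_iff, subSnd_eq_inl_iff]
  congr 1
  · let f : E ↪ Slots fun e => n e + 1 :=
      ⟨fun e => ⟨(e, 0), Nat.succ_pos _⟩, fun a b h => congrArg (fun p => p.1.1) h⟩
    calc _ = ∑ p ∈ R.map f, if p.1.2 = 0 ∧ s p.1.1 = v then (1 : ℤ) else 0 := by
          symm
          refine Finset.sum_subset (fun p hp => ?_) fun p hp hnp => if_neg fun h => hnp ?_
          · obtain ⟨e, he, rfl⟩ := Finset.mem_map.1 hp
            exact mem_liftSlots.2 he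
          · rw [Finset.mem_map]
            exact ⟨p.1.1, mem_liftSlots.1 hp, Subtype.ext (Prod.ext rfl h.1.symm)⟩
      _ = _ := by
          rw [Finset.sum_map]
          exact Finset.sum_congr rfl fun e _ => if_congr (and_iff_right rfl) rfl rfl
  · let f : E ↪ Slots fun e => n e + 1 :=
      ⟨fun e => ⟨(e, n e), Nat.lt_succ_self _⟩, fun a b h => congrArg (fun p => p.1.1) h⟩
    calc _ = ∑ p ∈ R.map f, if p.1.2 = n p.1.1 ∧ t p.1.1 = v then (1 : ℤ) else 0 := by
          symm
          refine Finset.sum_subset (fun p hp => ?_) fun p hp hnp => if_neg fun h => hnp ?_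
          · obtain ⟨e, he, rfl⟩ := Finset.mem_map.1 hp
            exact mem_liftSlots.2 he
          · rw [Finset.mem_map]
            exact ⟨p.1.1, mem_liftSlots.1 hp, Subtype.ext (Prod.ext rfl h.1.symm)⟩
      _ = _ := by
          rw [Finset.sum_map]
          exact Finset.sum_congr rfl fun e _ => if_congr (and_iff_right rfl) rfl rfl

/-- Old vertices keep their degree, and each inner vertex of an edge in `R` has degree `2`. The
resulting sign depends only on `R` and the lengths, so it can be cancelled later. -/
theorem defect_lift [Fintype V] (R : Finset E) :
    defect (subFst s n) (subSnd t n) (liftSlots n R) =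
      defect s t R * ∏ q : Slots n, if q.1.1 ∈ R then -1 else 1 := by
  rw [defect, Fintype.prod_sum_type, defect]
  congr 1
  · exact Finset.prod_congr rfl fun v _ => by rw [degIn_lift_inl]
  · refine Finset.prod_congr rfl fun q _ => ?_
    rw [degIn_lift_inr]
    split_ifs <;> norm_num

theorem prod_sign_ne_zero (R : Finset E) :
    (∏ q : Slots n, if q.1.1 ∈ R then (-1 : ℤ) else 1) ≠ 0 := by
  refine Finset.prod_ne_zero_iff.2 fun q _ => ?_
  split_ifs <;> norm_num

omit [DecidableEq V] [DecidableEq E] [Fintype E] in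
/-- A subdivision does not depend on the orientation of the edges. -/
theorem endsIso_sub_of_sym2_eq {s' t' : E → V} (h : ∀ e, s(s e, t e) = s(s' e, t' e)) :
    EndsIso (subFst s n) (subSnd t n) (subFst s' n) (subSnd t' n) := by
  classical
  let F : E → Prop := fun e => ¬ (s e = s' e ∧ t e = t' e)
  have hF : ∀ e, F e → s e = t' e ∧ t e = s' e := by
    intro e he
    rcases Sym2.eq_iff.1 (h e) with h1 | h1
    · exact absurd h1 he
    · exact h1
  have hF' : ∀ e, ¬ F e → s e = s' e ∧ t e = t' e := fun e he => not_not.1 he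
  -- On edges whose orientation differs, pieces and inner vertices are numbered from the other end.
  let flip : ∀ k : E → ℕ, Slots k → Slots k := fun k p =>
    if F p.1.1 then ⟨(p.1.1, k p.1.1 - 1 - p.1.2), by have := p.2; simp only; omega⟩ else p
  have hinv : ∀ k, Function.Involutive (flip k) := by
    intro k p
    by_cases hp : F p.1.1
    · simp only [flip, hp, if_true]
      refine Subtype.ext (Prod.ext rfl ?_)
      have := p.2
      simp only
      omega
    · simp only [flip, hp, if_false]
  refine ⟨Equiv.sumCongr (Equiv.refl V) (hinv n).toPerm, (hinv fun e => n e + 1).toPerm, ?_⟩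
  rintro ⟨⟨e, i⟩, hi⟩
  simp only at hi
  by_cases he : F e
  · obtain ⟨h1, h2⟩ := hF e he
    rw [Sym2.eq_iff]
    right
    simp only [Function.Involutive.coe_toPerm, flip, he, if_true]
    constructor
    · by_cases h0 : i = 0
      · subst h0
        simp [subFst, subSnd, h1]
      · have h3 : n e - i < n e := by omega
        have h4 : n e - 1 - (i - 1) = n e - i := by omega
        simp [subFst, subSnd, h0, h3, flip, he, h4]
    · by_cases h0 : i < n e
      · have h3 : n e - i ≠ 0 := by omega
        have h4 : n e - 1 - i = n e - i - 1 := by omega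
        simp [subFst, subSnd, h0, h3, flip, he, h4]
      · have h3 : n e - i = 0 := by omega
        simp [subFst, subSnd, h0, h3, h2]
  · obtain ⟨h1, h2⟩ := hF' e he
    rw [Sym2.eq_iff]
    left
    simp only [Function.Involutive.coe_toPerm, flip, he, if_false]
    constructor
    · by_cases h0 : i = 0 <;> simp [subFst, h0, h1, flip, he]
    · by_cases h0 : i < n e <;> simp [subSnd, h0, h2, flip, he]

/-- Slots are transported along a bijection of edges. -/
def slotsRelabel {E E' : Type*} (ψ : E ≃ E') (k : E' → ℕ) : Slots (k ∘ ψ) ≃ Slots k where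
  toFun p := ⟨(ψ p.1.1, p.1.2), p.2⟩
  invFun p := ⟨(ψ.symm p.1.1, p.1.2), by simpa using p.2⟩
  left_inv p := by simp
  right_inv p := by simp

omit [DecidableEq V] [DecidableEq E] [Fintype E] in
theorem endsIso_sub_relabel {V' E' : Type*} (φ : V ≃ V') (ψ : E ≃ E') (s t : E → V) (m : E' → ℕ) :
    EndsIso (subFst s (m ∘ ψ)) (subSnd t (m ∘ ψ)) (subFst (φ ∘ s ∘ ψ.symm) m)
      (subSnd (φ ∘ t ∘ ψ.symm) m) := by
  refine ⟨Equiv.sumCongr φ (slotsRelabel ψ m), slotsRelabel ψ fun e => m e + 1, ?_⟩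
  rintro ⟨⟨e, i⟩, hi⟩
  rw [Sym2.eq_iff]
  left
  constructor
  · by_cases h0 : i = 0 <;> simp [subFst, h0, slotsRelabel]
  · by_cases h0 : i < m (ψ e) <;> simp [subSnd, h0, slotsRelabel]

end Subdivision

/-! ### Recovering a subdivision from its defects. -/

section SubdivisionIso

variable {V E V' E' : Type*} [DecidableEq V] [DecidableEq E] [DecidableEq V'] [DecidableEq E']
  [Fintype V] [Fintype E] [Fintype V'] [Fintype E'] {s t : E → V} {s' t' : E' → V'}
  {n : E → ℕ} {m : E' → ℕ}

/-- In a subdivision of a reduced multigraph, the sets of nonzero defect tell which pieces belong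
to the same edge. -/
theorem IsReducedEnds.fst_eq_iff (h : IsReducedEnds s t) {p q : Slots fun e => n e + 1} :
    p.1.1 = q.1.1 ↔
      ∀ R, defect (subFst s n) (subSnd t n) R ≠ 0 → (p ∈ R ↔ q ∈ R) := by
  refine ⟨fun hpq R hR => mem_iff_of_defect_sub_ne_zero hR hpq, fun hall => ?_⟩
  by_contra hne
  obtain ⟨R, hR, hsep⟩ := h.exists_separating hne
  refine hsep ?_
  have := hall (liftSlots n R) (by rw [defect_lift]; exact mul_ne_zero hR (prod_sign_ne_zero R))
  simpa only [mem_liftSlots] using this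

omit [DecidableEq V'] [DecidableEq E] [DecidableEq E'] [Fintype V'] in
theorem IsReducedEnds.comp_equiv [DecidableEq V'] (h : IsReducedEnds s' t') (ψ : E ≃ E') :
    IsReducedEnds (s' ∘ ψ) (t' ∘ ψ) := by
  intro v
  have h1 : degIn (s' ∘ ψ) (t' ∘ ψ) Finset.univ v = degIn s' t' Finset.univ v := by
    have := degIn_map (s := s' ∘ ψ) (t := t' ∘ ψ) (s' := s') (t' := t') (φ := Equiv.refl V')
      (ψ := ψ) (fun e => rfl) Finset.univ v
    rwa [Finset.map_univ_equiv] at this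
  rw [h1]
  refine (h v).imp_right fun ⟨h2, e, h3, h4⟩ => ⟨h2, ψ.symm e, ?_, ?_⟩ <;> simpa

omit [DecidableEq E] [Fintype E] in
theorem natCard_slots_fiber (k : E → ℕ) (e : E) : Nat.card {p : Slots k // p.1.1 = e} = k e := by
  rw [← Nat.card_fin (k e)]
  refine Nat.card_congr ⟨fun p => ⟨p.1.1.2, by have := p.1.2; rwa [p.2] at this⟩,
    fun i => ⟨⟨(e, i), i.2⟩, rfl⟩, ?_, fun i => rfl⟩
  rintro ⟨⟨⟨f, j⟩, hj⟩, rfl⟩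
  rfl

/-- Nonzero defects reveal which pieces lie on a common edge, so `τ` induces a bijection of reduced
edges. Counting pieces gives equal lengths, and defects of unions of whole edges give those of the
reduced graphs, to which reconstruction applies. -/
theorem IsReducedEnds.endsIso_sub (h : IsReducedEnds s t) (h' : IsReducedEnds s' t')
    (τ : (Slots fun e => n e + 1) ≃ Slots fun e => m e + 1)
    (hτ : ∀ R, defect (subFst s n) (subSnd t n) R =
      defect (subFst s' m) (subSnd t' m) (R.map τ.toEmbedding)) :
    EndsIso (subFst s n) (subSnd t n) (subFst s' m) (subSnd t' m) := by
  have hfib : ∀ p q : Slots fun e => n e + 1, p.1.1 = q.1.1 ↔ (τ p).1.1 = (τ q).1.1 := by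
    intro p q
    rw [h.fst_eq_iff, h'.fst_eq_iff]
    constructor
    · intro hall R hR
      have hmap : (R.map τ.symm.toEmbedding).map τ.toEmbedding = R := by
        ext x; simp
      have := hall (R.map τ.symm.toEmbedding) (by rwa [hτ, hmap])
      simpa using this
    · intro hall R hR
      have := hall (R.map τ.toEmbedding) (by rwa [← hτ])
      simpa using this
  have hψ : ∃ ψ : E ≃ E', ∀ p, (τ p).1.1 = ψ p.1.1 := by
    let f : E → E' := fun e => (τ ⟨(e, 0), Nat.succ_pos _⟩).1.1
    have hf : ∀ p, (τ p).1.1 = f p.1.1 := fun p => (hfib _ _).1 rfl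
    refine ⟨Equiv.ofBijective f ⟨fun a b hab => (hfib _ _).2 hab, fun e => ?_⟩, hf⟩
    refine ⟨(τ.symm ⟨(e, 0), Nat.succ_pos _⟩).1.1, ?_⟩
    rw [← hf, Equiv.apply_symm_apply]
  obtain ⟨ψ, hψ⟩ := hψ
  have hn : n = m ∘ ψ := by
    funext e
    have h1 := natCard_slots_fiber (fun e => n e + 1) e
    have h2 := natCard_slots_fiber (fun e => m e + 1) (ψ e)
    have h3 : Nat.card {p : Slots fun e => n e + 1 // p.1.1 = e} =
        Nat.card {p : Slots fun e => m e + 1 // p.1.1 = ψ e} :=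
      Nat.card_congr (τ.subtypeEquiv fun p => by rw [hψ, ψ.injective.eq_iff])
    rw [h1, h2] at h3
    exact Nat.succ_injective h3
  subst hn
  have hd : ∀ R, defect s t R = defect (s' ∘ ψ) (t' ∘ ψ) R := by
    intro R
    have h1 : (liftSlots (m ∘ ψ) R).map τ.toEmbedding = liftSlots m (R.map ψ.toEmbedding) := by
      ext p
      obtain ⟨q, rfl⟩ := τ.surjective p
      simp [mem_liftSlots, hψ]
    have h2 := hτ (liftSlots (m ∘ ψ) R)
    rw [h1, defect_lift, defect_lift] at h2
    have h3 : (∏ q : Slots (m ∘ ψ), if q.1.1 ∈ R then (-1 : ℤ) else 1) =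
        ∏ q : Slots m, if q.1.1 ∈ R.map ψ.toEmbedding then -1 else 1 := by
      refine Fintype.prod_equiv (slotsRelabel ψ m) _ _ fun p => ?_
      simp [slotsRelabel]
    rw [h3] at h2
    rw [mul_right_cancel₀ (prod_sign_ne_zero _) h2]
    exact (defect_map (s' := s') (t' := t') (φ := Equiv.refl V') (ψ := ψ) (fun e => rfl) R).symm
  obtain ⟨φ, hφ⟩ := h.exists_equiv (h'.comp_equiv ψ) hd
  refine (endsIso_sub_relabel φ ψ s t m).trans (endsIso_sub_of_sym2_eq fun e => ?_)
  have := hφ (ψ.symm e)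
  simpa using this

end SubdivisionIso

/-! ### Subdividing a single edge once. -/

section Split

variable {V E V' E' : Type*}

/-- The first ends after the edge `e` has been subdivided once. -/
def splitFst (s : E → V) : Option E → Option V
  | none => none
  | some g => some (s g)

/-- The second ends after the edge `e` has been subdivided once. -/
def splitSnd [DecidableEq E] (t : E → V) (e : E) : Option E → Option V
  | none => some (t e)
  | some g => if g = e then none else some (t g)

theorem endsIso_split [DecidableEq E] [DecidableEq E'] {s t : E → V} {s' t' : E' → V'}
    {φ : V ≃ V'} {ψ : E ≃ E'} (h : ∀ e, s(φ (s e), φ (t e)) = s(s' (ψ e), t' (ψ e))) (e : E) :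
    EndsIso (splitFst s) (splitSnd t e) (splitFst s') (splitSnd t' (ψ e)) := by
  have hoth : ∀ g, g ≠ e → s(Equiv.optionCongr φ (splitFst s (some g)),
      Equiv.optionCongr φ (splitSnd t e (some g))) =
      s(splitFst s' (some (ψ g)), splitSnd t' (ψ e) (some (ψ g))) := by
    intro g hg
    have h1 : ψ g ≠ ψ e := fun h => hg (ψ.injective h)
    simp only [splitFst, splitSnd, hg, h1, if_false, Equiv.optionCongr_apply, Option.map_some]
    simpa using congrArg (Sym2.map some) (h g)
  rcases Sym2.eq_iff.1 (h e) with ⟨h1, h2⟩ | ⟨h1, h2⟩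
  · refine ⟨Equiv.optionCongr φ, Equiv.optionCongr ψ, ?_⟩
    rintro (_ | g)
    · simp [splitFst, splitSnd, h2]
    · by_cases hg : g = e
      · subst hg
        simp [splitFst, splitSnd, h1]
      · exact hoth g hg
  -- The isomorphism reverses `e`, so the two halves of the split edge are exchanged.
  · refine ⟨Equiv.optionCongr φ, (Equiv.optionCongr ψ).trans (Equiv.swap none (some (ψ e))), ?_⟩
    rintro (_ | g)
    · have h3 : (Equiv.optionCongr ψ).trans (Equiv.swap none (some (ψ e))) none = some (ψ e) := by
        simp
      rw [h3, Sym2.eq_swap]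
      simp [splitFst, splitSnd, h2]
    · by_cases hg : g = e
      · subst hg
        have h3 : (Equiv.optionCongr ψ).trans (Equiv.swap none (some (ψ g))) (some g) = none := by
          simp
        rw [h3, Sym2.eq_swap]
        simp [splitFst, splitSnd, h1]
      · have h3 : ψ g ≠ ψ e := fun h => hg (ψ.injective h)
        have h4 : (Equiv.optionCongr ψ).trans (Equiv.swap none (some (ψ e))) (some g) =
            some (ψ g) := by
          rw [Equiv.trans_apply]
          exact Equiv.swap_apply_of_ne_of_ne (by simp) (by simpa using h3)
        rw [h4]
        exact hoth g hg

/-- Insertion of one slot at `(c, i)`. -/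
def slotInsert [DecidableEq E] {k k' : E → ℕ} (c : E) (i : ℕ) (hi : i ≤ k c)
    (hk : ∀ d, k' d = if d = c then k d + 1 else k d) : Option (Slots k) ≃ Slots k' where
  toFun
    | none => ⟨(c, i), by simp only [hk]; simp; omega⟩
    | some p => ⟨(p.1.1, if p.1.1 = c ∧ i ≤ p.1.2 then p.1.2 + 1 else p.1.2), by
        have := p.2
        simp only [hk]
        split_ifs <;> first | omega | simp_all⟩
  invFun p := if h : p.1.1 = c ∧ p.1.2 = i then none else
    some ⟨(p.1.1, if p.1.1 = c ∧ i < p.1.2 then p.1.2 - 1 else p.1.2), by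
      have := p.2
      rw [hk] at this
      obtain ⟨⟨d, j⟩, hj⟩ := p
      simp only at h this ⊢
      by_cases hd : d = c
      · subst hd
        simp only [if_true, true_and] at h this ⊢
        split_ifs <;> omega
      · simpa [hd] using this⟩
  left_inv := by
    rintro (_ | ⟨⟨d, j⟩, hj⟩)
    · simp
    · by_cases hd : d = c
      · subst hd
        by_cases hij : i ≤ j
        · have h1 : j + 1 ≠ i := by omega
          have h2 : i < j + 1 := by omega
          simp [hij, h1, h2]
        · have h1 : j ≠ i := by omega
          have h2 : ¬ i < j := by omega
          simp [hij, h1, h2]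
      · simp [hd]
  right_inv := by
    rintro ⟨⟨d, j⟩, hj⟩
    by_cases hd : d = c
    · subst hd
      by_cases h0 : j = i
      · subst h0; simp
      · by_cases hij : i < j
        · have h1 : i ≤ j - 1 := by omega
          have h2 : j - 1 + 1 = j := by omega
          simp [h0, hij, h1, h2]
        · have h1 : ¬ i ≤ j := by omega
          simp [h0, hij, h1]
    · simp [hd]

/-- Splitting piece `i` of `c` inserts an inner vertex at position `i` and a piece at position `i +
1`, so the result is again a subdivision of the same graph. -/
theorem endsIso_split_sub [DecidableEq E] (s t : E → V) (n : E → ℕ)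
    (p : Slots fun e => n e + 1) :
    ∃ n' : E → ℕ, EndsIso (splitFst (subFst s n)) (splitSnd (subSnd t n) p)
      (subFst s n') (subSnd t n') := by
  obtain ⟨⟨c, i⟩, hi⟩ := p
  simp only at hi
  let n' : E → ℕ := fun d => if d = c then n d + 1 else n d
  let φ₀ : Option (Slots n) ≃ Slots n' := slotInsert c i (by omega) fun d => rfl
  let φ : Option (V ⊕ Slots n) ≃ V ⊕ Slots n' :=
    { toFun := fun x => match x with
        | none => Sum.inr (φ₀ none)
        | some (Sum.inl v) => Sum.inl v
        | some (Sum.inr q) => Sum.inr (φ₀ (some q))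
      invFun := fun x => match x with
        | Sum.inl v => some (Sum.inl v)
        | Sum.inr q => (φ₀.symm q).map Sum.inr
      left_inv := by rintro (_ | v | q) <;> simp
      right_inv := by
        rintro (v | q)
        · rfl
        · have h' := φ₀.apply_symm_apply q
          rcases h : φ₀.symm q with _ | q' <;> rw [h] at h' <;> simp [h, h'] }
  let ψ : Option (Slots fun e => n e + 1) ≃ Slots fun e => n' e + 1 :=
    slotInsert c (i + 1) (by omega) fun d => by
      change (if d = c then n d + 1 else n d) + 1 = if d = c then n d + 1 + 1 else n d + 1
      split_ifs <;> rfl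
  refine ⟨n', φ, ψ, fun g => ?_⟩
  rw [Sym2.eq_iff]
  left
  rcases g with _ | ⟨⟨d, j⟩, hj⟩
  · constructor
    · simp [splitFst, φ, ψ, φ₀, slotInsert, subFst]
    · by_cases h : i < n c
      · simp [splitSnd, φ, ψ, φ₀, slotInsert, subSnd, h, n']
      · simp [splitSnd, φ, ψ, φ₀, slotInsert, subSnd, h, n']
  · simp only at hj
    by_cases hd : d = c
    · subst hd
      constructor
      · by_cases h0 : j = 0
        · subst h0
          simp [splitFst, φ, ψ, slotInsert, subFst]
        · by_cases h1 : i < j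
          · have h2 : i ≤ j - 1 := by omega
            have h3 : j - 1 + 1 = j := by omega
            simp [splitFst, φ, ψ, φ₀, slotInsert, subFst, h0, h1, h2, h3]
          · have h2 : ¬ i ≤ j - 1 := by omega
            simp [splitFst, φ, ψ, φ₀, slotInsert, subFst, h0, h1, h2]
      · rcases lt_trichotomy j i with h1 | h1 | h1
        · have h2 : j ≠ i := h1.ne
          have h3 : j < n d := by omega
          have h4 : ¬ i ≤ j := by omega
          have h5 : ¬ i < j := by omega
          simp [splitSnd, φ, ψ, φ₀, slotInsert, subSnd, h2, h3, h4, h5, n', Nat.lt_succ_of_lt h3]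
        · subst h1
          simp [splitSnd, φ, ψ, φ₀, slotInsert, subSnd, n', hj]
        · have h2 : j ≠ i := h1.ne'
          have h4 : i ≤ j := by omega
          have h5 : i < j := h1
          by_cases h3 : j < n d
          · simp [splitSnd, φ, ψ, φ₀, slotInsert, subSnd, h2, h3, h4, h5, n']
          · simp [splitSnd, φ, ψ, φ₀, slotInsert, subSnd, h2, h3, h5, n']
    · constructor
      · by_cases h0 : j = 0 <;> simp [splitFst, φ, ψ, φ₀, slotInsert, subFst, h0, hd]
      · by_cases h0 : j < n d <;> simp [splitSnd, φ, ψ, φ₀, slotInsert, subSnd, h0, hd, n']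

end Split

/-! ### Suppressing vertices of degree `2`. -/

section Contraction

universe u v

variable {V : Type u} {E : Type v}

theorem endsIso_sub_zero (s t : E → V) :
    EndsIso s t (subFst s fun _ => 0) (subSnd t fun _ => 0) := by
  have : IsEmpty (Slots fun _ : E => 0) := ⟨fun p => absurd p.2 (Nat.not_lt_zero _)⟩
  refine ⟨(Equiv.sumEmpty V _).symm,
    ⟨fun e => ⟨(e, 0), Nat.one_pos⟩, fun p => p.1.1, fun e => rfl, ?_⟩, fun e => ?_⟩
  · rintro ⟨⟨e, i⟩, hi⟩
    simp only [zero_add, Nat.lt_one_iff] at hi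
    subst hi
    rfl
  · simp [subFst, subSnd]

/-- Without a loop, `v` lies on exactly two edges, `e` to `x` and `f` to `y`. Remove `v` and `f` and
let `e` run from `x` to `y`, as a loop if `x = y`; splitting `e` undoes this. -/
theorem exists_contraction [Fintype V] [Fintype E] [DecidableEq V] [DecidableEq E] {s t : E → V}
    (hdeg : ∀ w, 2 ≤ degIn s t Finset.univ w) {v : V} (hv : degIn s t Finset.univ v = 2)
    (hnl : ∀ e, s e = v → t e ≠ v) :
    ∃ (f : E) (e : {g // g ≠ f}) (s₁ t₁ : {g // g ≠ f} → {w // w ≠ v}),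
      (∀ w, 2 ≤ degIn s₁ t₁ Finset.univ w) ∧
      EndsIso s t (splitFst s₁) (splitSnd t₁ e) := by
  classical
  have hone : ∀ g, endCount s t v g = if IsEnd s t v g then 1 else 0 := by
    intro g
    split_ifs with hg
    · refine endCount_of_ne (fun hl => ?_) hg
      rcases hg with h | h
      · exact hnl g h (hl ▸ h)
      · exact hnl g (hl.trans h) h
    · exact endCount_eq_zero hg
  have hcard : (Finset.univ.filter fun g => IsEnd s t v g).card = 2 := by
    have : ((Finset.univ.filter fun g => IsEnd s t v g).card : ℤ) = 2 := by
      rw [← hv, degIn, Finset.sum_congr rfl fun g _ => hone g, Finset.sum_boole]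
    exact_mod_cast this
  obtain ⟨e, f, hef, hset⟩ := Finset.card_eq_two.1 hcard
  have hmem : ∀ g, IsEnd s t v g ↔ g = e ∨ g = f := fun g => by
    simpa using Finset.ext_iff.1 hset g
  have hve := (hmem e).2 (Or.inl rfl)
  have hvf := (hmem f).2 (Or.inr rfl)
  have hl : ∀ g, IsEnd s t v g → s g ≠ t g := fun g hg hl => by
    rcases hg with h | h
    · exact hnl g h (hl ▸ h)
    · exact hnl g (hl.trans h) h
  obtain ⟨x, hx, hex⟩ := exists_other_end (hl e hve) hve
  obtain ⟨y, hy, hfy⟩ := exists_other_end (hl f hvf) hvf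
  have hsne : ∀ g : {g // g ≠ f}, g.1 ≠ e → s g ≠ v := fun g hg h => by
    rcases (hmem g).1 (Or.inl h) with h | h
    · exact hg h
    · exact g.2 h
  have htne : ∀ g : {g // g ≠ f}, g.1 ≠ e → t g ≠ v := fun g hg h => by
    rcases (hmem g).1 (Or.inr h) with h | h
    · exact hg h
    · exact g.2 h
  let s₁ : {g // g ≠ f} → {w // w ≠ v} := fun g =>
    if h : g.1 = e then ⟨x, hx⟩ else ⟨s g, hsne g h⟩
  let t₁ : {g // g ≠ f} → {w // w ≠ v} := fun g =>
    if h : g.1 = e then ⟨y, hy⟩ else ⟨t g, htne g h⟩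
  have hende : ∀ {g z a b}, (∀ z, IsEnd s t z g ↔ z = a ∨ z = b) → s g ≠ t g →
      endCount s t z g = (if a = z then 1 else 0) + if b = z then 1 else 0 := by
    intro g z a b hab hsl
    have h1 := (hab (s g)).1 (Or.inl rfl)
    have h2 := (hab (t g)).1 (Or.inr rfl)
    rcases h1 with h1 | h1 <;> rcases h2 with h2 | h2
    · exact absurd (h1.trans h2.symm) hsl
    · rw [endCount, h1, h2]
    · rw [endCount, h1, h2, add_comm]
    · exact absurd (h1.trans h2.symm) hsl
  refine ⟨f, ⟨e, hef⟩, s₁, t₁, fun w => ?_, ?_⟩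
  · have hsub : degIn s₁ t₁ Finset.univ w = degIn s t Finset.univ w.1 := by
      have hw : w.1 ≠ v := w.2
      -- The new `e` inherits the end of `f` at `y`, so degrees away from `v` are unchanged.
      have h1 : ∀ g : {g // g ≠ f}, endCount s₁ t₁ w g =
          endCount s t w.1 g + if g.1 = e then endCount s t w.1 f else 0 := by
        intro g
        by_cases hg : g.1 = e
        · rw [if_pos hg, hg, hende hex (hl e hve), hende hfy (hl f hvf), if_neg hw.symm, zero_add,
            zero_add]
          simp [endCount, s₁, t₁, hg, Subtype.ext_iff]
        · rw [if_neg hg, add_zero]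
          simp [endCount, s₁, t₁, hg, Subtype.ext_iff]
      rw [degIn, Finset.sum_congr rfl fun g _ => h1 g, Finset.sum_add_distrib, degIn,
        ← Finset.add_sum_erase Finset.univ _ (Finset.mem_univ f), add_comm]
      congr 1
      · rw [Finset.sum_eq_single_of_mem ⟨e, hef⟩ (Finset.mem_univ _)]
        · simp
        · intro g _ hg
          exact if_neg fun h => hg (Subtype.ext h)
      · symm
        refine Finset.sum_subtype _ (fun g => ?_) _
        simp
    rw [hsub]
    exact hdeg w.1
  · refine ⟨(Equiv.optionSubtypeNe v).symm, (Equiv.optionSubtypeNe f).symm, fun g => ?_⟩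
    have hsym : ∀ {a b c d : V}, (∀ z, z = a ∨ z = b ↔ z = c ∨ z = d) → a ≠ b →
        s(a, b) = s(c, d) := by
      intro a b c d h hab
      rw [Sym2.eq_iff]
      rcases (h a).1 (Or.inl rfl) with h1 | h1 <;> rcases (h b).1 (Or.inr rfl) with h2 | h2
      · exact absurd (h1.trans h2.symm) hab
      · exact Or.inl ⟨h1, h2⟩
      · exact Or.inr ⟨h1, h2⟩
      · exact absurd (h1.trans h2.symm) hab
    have hends : ∀ {g a b}, (∀ z, IsEnd s t z g ↔ z = a ∨ z = b) → s g ≠ t g →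
        s(s g, t g) = s(a, b) := by
      intro g a b hab hsl
      refine hsym (fun z => ?_) hsl
      rw [← hab, IsEnd, eq_comm, eq_comm (a := z)]
    have hne : ∀ {w : V} (hw : w ≠ v),
        (Equiv.optionSubtypeNe v).symm w = some ⟨w, hw⟩ := fun hw =>
      Equiv.optionSubtypeNe_symm_of_ne hw
    have hself : (Equiv.optionSubtypeNe v).symm v = none := Equiv.optionSubtypeNe_symm_self v
    by_cases hgf : g = f
    · subst hgf
      have := congrArg (Sym2.map (Equiv.optionSubtypeNe v).symm) (hends hfy (hl g hvf))
      simp only [Sym2.map_mk] at this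
      rw [this, hself, hne hy, Equiv.optionSubtypeNe_symm_self]
      simp [splitFst, splitSnd, t₁]
    · rw [Equiv.optionSubtypeNe_symm_of_ne hgf]
      by_cases hge : g = e
      · subst hge
        have := congrArg (Sym2.map (Equiv.optionSubtypeNe v).symm) (hends hex (hl g hve))
        simp only [Sym2.map_mk] at this
        rw [this, hself, hne hx, Sym2.eq_swap]
        simp [splitFst, splitSnd, s₁]
      · rw [hne (hsne ⟨g, hgf⟩ hge), hne (htne ⟨g, hgf⟩ hge)]
        simp [splitFst, splitSnd, s₁, t₁, hge]

/-- Every multigraph of minimum degree at least `2` is a subdivision of a reduced one. -/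
theorem exists_endsIso_sub_reduced (N : ℕ) : ∀ {V : Type u} {E : Type v} [Fintype V] [Fintype E]
    [DecidableEq V] (s t : E → V), Fintype.card E = N → (∀ w, 2 ≤ degIn s t Finset.univ w) →
    ∃ (V' : Type u) (E' : Type v) (_ : Fintype V') (_ : Fintype E') (_ : DecidableEq V')
      (s' t' : E' → V') (n : E' → ℕ),
      IsReducedEnds s' t' ∧ EndsIso s t (subFst s' n) (subSnd t' n) := by
  classical
  induction N with
  | zero =>
    intro V E _ _ _ s t hN hdeg
    -- Without edges all degrees are `0`, so the degree bound leaves no vertices.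
    have : IsEmpty E := Fintype.card_eq_zero_iff.1 hN
    refine ⟨V, E, inferInstance, inferInstance, inferInstance, s, t, fun _ => 0, fun v => ?_,
      endsIso_sub_zero s t⟩
    have := hdeg v
    simp [degIn] at this
  | succ N ih =>
    intro V E _ _ _ s t hN hdeg
    by_cases hred : IsReducedEnds s t
    · exact ⟨V, E, inferInstance, inferInstance, inferInstance, s, t, fun _ => 0, hred,
        endsIso_sub_zero s t⟩
    · simp only [IsReducedEnds, not_forall, not_or] at hred
      obtain ⟨v, h3, h2⟩ := hred
      have hv : degIn s t Finset.univ v = 2 := by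
        have := hdeg v
        omega
      have hnl : ∀ e, s e = v → t e ≠ v := fun e h h' => h2 ⟨hv, e, h, h'⟩
      obtain ⟨f, e, s₁, t₁, hdeg₁, hiso⟩ := exists_contraction hdeg hv hnl
      have hcard : Fintype.card {g // g ≠ f} = N := by
        rw [Fintype.card_subtype_compl, Fintype.card_subtype_eq, hN, Nat.add_sub_cancel]
      obtain ⟨V', E', i₁, i₂, i₃, s', t', n, hr, φ, ψ, hφ⟩ := ih s₁ t₁ hcard hdeg₁
      obtain ⟨n', hn'⟩ := endsIso_split_sub s' t' n (ψ e)
      exact ⟨V', E', i₁, i₂, i₃, s', t', n', hr, hiso.trans ((endsIso_split hφ e).trans hn')⟩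

end Contraction

/-! ### Graph isomorphisms, invariance of the counts, and the conclusion. -/

namespace Graph

variable {α β γ δ ε ζ : Type*}

/-- The inverse of an isomorphism. -/
def Iso.symm {G : Graph α β} {H : Graph γ δ} (i : Iso G H) : Iso H G where
  onVertices := i.onVertices.symm
  onEdges := i.onEdges.symm
  isLink_iff e x y := by
    rw [← i.isLink_iff]
    simp

/-- The composition of two isomorphisms. -/
def Iso.trans {G : Graph α β} {H : Graph γ δ} {K : Graph ε ζ} (i : Iso G H) (j : Iso H K) :
    Iso G K where
  onVertices := i.onVertices.trans j.onVertices
  onEdges := i.onEdges.trans j.onEdges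
  isLink_iff e x y := by
    rw [← i.isLink_iff, ← j.isLink_iff]
    rfl

/-- The restriction of a bijection between two sets to subsets that correspond to each other. -/
def _root_.Equiv.restrictSets {A : Set α} {B : Set γ} (φ : A ≃ B) {A' : Set α} {B' : Set γ}
    (hA : A' ⊆ A) (hB : B' ⊆ B) (h : ∀ x : A, (x : α) ∈ A' ↔ (φ x : γ) ∈ B') : A' ≃ B' where
  toFun x := ⟨φ ⟨x, hA x.2⟩, (h _).1 x.2⟩
  invFun y := ⟨φ.symm ⟨y, hB y.2⟩, (h _).2 (by simp)⟩
  left_inv x := by simp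
  right_inv y := by simp

/-- An isomorphism restricts to subgraphs that correspond to each other. -/
theorem Iso.restrict {G G' : Graph α β} {H H' : Graph γ δ} (i : Iso G H)
    (hVG : V(G') ⊆ V(G)) (hVH : V(H') ⊆ V(H)) (hEG : E(G') ⊆ E(G)) (hEH : E(H') ⊆ E(H))
    (hv : ∀ x : V(G), (x : α) ∈ V(G') ↔ (i.onVertices x : γ) ∈ V(H'))
    (hl : ∀ (e : E(G)) (x y : V(G)), H'.IsLink (i.onEdges e) (i.onVertices x) (i.onVertices y) ↔
      G'.IsLink e x y) : Nonempty (Iso G' H') := by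
  have he : ∀ e : E(G), (e : β) ∈ E(G') ↔ (i.onEdges e : δ) ∈ E(H') := by
    intro e
    rw [G'.edge_mem_iff_exists_isLink, H'.edge_mem_iff_exists_isLink]
    constructor
    · rintro ⟨x, y, h⟩
      exact ⟨_, _, (hl e ⟨x, hVG h.left_mem⟩ ⟨y, hVG h.right_mem⟩).2 h⟩
    · rintro ⟨x, y, h⟩
      obtain ⟨x', hx⟩ := i.onVertices.surjective ⟨x, hVH h.left_mem⟩
      obtain ⟨y', hy⟩ := i.onVertices.surjective ⟨y, hVH h.right_mem⟩
      refine ⟨x', y', (hl e x' y').1 ?_⟩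
      rwa [hx, hy]
  exact ⟨⟨i.onVertices.restrictSets hVG hVH hv, i.onEdges.restrictSets hEG hEH he,
    fun e x y => hl ⟨e, hEG e.2⟩ ⟨x, hVG x.2⟩ ⟨y, hVG y.2⟩⟩⟩

/-- The image of a set of vertices or of edges under a bijection. -/
def _root_.Equiv.imageSets {A : Set α} {B : Set γ} (φ : A ≃ B) (S : Set α) : Set γ :=
  {y | ∃ x : A, (x : α) ∈ S ∧ (φ x : γ) = y}

theorem _root_.Equiv.mem_imageSets {A : Set α} {B : Set γ} (φ : A ≃ B) {S : Set α} (x : A) :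
    (φ x : γ) ∈ φ.imageSets S ↔ (x : α) ∈ S := by
  constructor
  · rintro ⟨y, hy, h⟩
    rwa [← φ.injective (Subtype.ext h)]
  · exact fun h => ⟨x, h, rfl⟩

theorem _root_.Equiv.imageSets_subset {A : Set α} {B : Set γ} (φ : A ≃ B) (S : Set α) :
    φ.imageSets S ⊆ B := by
  rintro _ ⟨x, -, rfl⟩
  exact (φ x).2

theorem _root_.Equiv.imageSets_injOn {A : Set α} {B : Set γ} (φ : A ≃ B) {S T : Set α}
    (hS : S ⊆ A) (hT : T ⊆ A) (h : φ.imageSets S = φ.imageSets T) : S = T := by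
  ext x
  constructor
  · intro hx
    rwa [← φ.mem_imageSets ⟨x, hS hx⟩, ← h, φ.mem_imageSets]
  · intro hx
    rwa [← φ.mem_imageSets ⟨x, hT hx⟩, h, φ.mem_imageSets]

theorem Iso.inc_iff {G : Graph α β} {H : Graph γ δ} (i : Iso G H) (e : E(G)) (x : V(G)) :
    H.Inc (i.onEdges e) (i.onVertices x) ↔ G.Inc e x := by
  constructor
  · rintro ⟨y, hy⟩
    obtain ⟨y', hy'⟩ := i.onVertices.surjective ⟨y, hy.right_mem⟩
    refine ⟨y', (i.isLink_iff e x y').1 ?_⟩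
    rwa [hy']
  · rintro ⟨y, hy⟩
    exact ⟨_, (i.isLink_iff e x ⟨y, hy.right_mem⟩).2 hy⟩

theorem Iso.vertexInducedCount_le {X : Graph α β} {Y : Graph γ δ} (i : Iso X Y)
    [Finite V(Y)] (W : Graph ε ζ) : W.vertexInducedCount X ≤ W.vertexInducedCount Y := by
  refine Set.ncard_le_ncard_of_injOn i.onVertices.imageSets ?_
    (fun S hS T hT h => i.onVertices.imageSets_injOn hS.1 hT.1 h) ?_
  · rintro S ⟨hS, ⟨j⟩⟩
    have hT := i.onVertices.imageSets_subset S
    refine ⟨hT, ?_⟩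
    obtain ⟨k⟩ := i.restrict (G' := X.induce S) (H' := Y.induce (i.onVertices.imageSets S)) hS hT
      (fun e ⟨x, y, h, _⟩ => h.edge_mem) (fun e ⟨x, y, h, _⟩ => h.edge_mem)
      (fun x => (i.onVertices.mem_imageSets x).symm) fun e x y => by
        simp only [induce_isLink, i.isLink_iff, i.onVertices.mem_imageSets]
    exact ⟨k.symm.trans j⟩
  · exact (Set.toFinite V(Y)).finite_subsets.subset fun T hT => hT.1

theorem Iso.edgeInducedCount_le {X : Graph α β} {Y : Graph γ δ} (i : Iso X Y)
    [Finite E(Y)] (W : Graph ε ζ) : W.edgeInducedCount X ≤ W.edgeInducedCount Y := by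
  refine Set.ncard_le_ncard_of_injOn i.onEdges.imageSets ?_
    (fun S hS T hT h => i.onEdges.imageSets_injOn hS.1 hT.1 h) ?_
  · rintro R ⟨hR, ⟨j⟩⟩
    have hT := i.onEdges.imageSets_subset R
    refine ⟨hT, ?_⟩
    obtain ⟨k⟩ := i.restrict (G' := X.edgeInduce R) (H' := Y.edgeInduce (i.onEdges.imageSets R))
      (fun x ⟨e, _, h⟩ => h.vertex_mem) (fun x ⟨e, _, h⟩ => h.vertex_mem)
      (fun e ⟨x, y, h⟩ => h.2.edge_mem) (fun e ⟨x, y, h⟩ => h.2.edge_mem)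
      (fun x => by
        constructor
        · rintro ⟨e, he, h⟩
          exact ⟨i.onEdges ⟨e, hR he⟩, (i.onEdges.mem_imageSets _).2 he,
            (i.inc_iff ⟨e, hR he⟩ x).2 h⟩
        · rintro ⟨_, ⟨e, he, rfl⟩, h⟩
          exact ⟨e, he, (i.inc_iff e x).1 h⟩)
      fun e x y => and_congr (i.onEdges.mem_imageSets e) (i.isLink_iff e x y)
    exact ⟨k.symm.trans j⟩
  · exact (Set.toFinite E(Y)).finite_subsets.subset fun T hT => hT.1

theorem sym2_coe_eq_iff {A : Type*} {S : Set A} {a b c d : S} :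
    s((a : A), (b : A)) = s((c : A), (d : A)) ↔ s(a, b) = s(c, d) := by
  simp [Subtype.ext_iff]

theorem nonempty_iso_of_endsIso {X : Graph α β} {Y : Graph γ δ}
    (h : EndsIso X.fstEnd X.sndEnd Y.fstEnd Y.sndEnd) : Nonempty (Iso X Y) := by
  obtain ⟨φ, ψ, h⟩ := h
  refine ⟨⟨φ, ψ, fun e x y => ?_⟩⟩
  rw [(X.isLink_ends e).isLink_iff_sym2_eq, (Y.isLink_ends (ψ e)).isLink_iff_sym2_eq]
  rw [sym2_coe_eq_iff, sym2_coe_eq_iff, ← h]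
  simp [φ.injective.eq_iff]

open Classical in
theorem degIn_univ_eq_degree (X : Graph α β) [Fintype E(X)] (v : V(X)) :
    degIn X.fstEnd X.sndEnd Finset.univ v = X.degree v := by
  have : Fintype X.Arc := Fintype.ofFinite _
  rw [← card_arc_source_eq_degIn, degree, ← Nat.card_coe_set_eq, ← Nat.card_eq_fintype_card]
  norm_cast
  refine Nat.card_congr ⟨fun a => ⟨a.1.1, congrArg Subtype.val a.2⟩,
    fun a => ⟨⟨a.1, Finset.mem_univ _⟩, Subtype.ext a.2⟩, fun a => rfl, fun a => rfl⟩

/-- The edge zeta function, with the pairing of the variables of inverse arcs, determines a graph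
of minimum degree at least `2` up to isomorphism. -/
theorem nonempty_iso_of_edgeZeta_eq (X : Graph α β) [Finite V(X)] [Finite E(X)]
    (Y : Graph γ δ) [Finite V(Y)] [Finite E(Y)] (hX : X.MD2) (hY : Y.MD2)
    (σ : X.Arc ≃ Y.Arc) (hσ : ∀ a : X.Arc, σ a.rev = (σ a).rev)
    (hζ : ∀ᶠ u : Y.Arc → ℂ in nhds 0, X.edgeZeta (fun a => u (σ a)) = Y.edgeZeta u) :
    Nonempty (Iso X Y) := by
  classical
  have : Fintype V(X) := Fintype.ofFinite _
  have : Fintype E(X) := Fintype.ofFinite _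
  have : Fintype V(Y) := Fintype.ofFinite _
  have : Fintype E(Y) := Fintype.ofFinite _
  have hdX : ∀ v, 2 ≤ degIn X.fstEnd X.sndEnd Finset.univ v := fun v => by
    rw [X.degIn_univ_eq_degree v]
    exact_mod_cast hX v v.2
  have hdY : ∀ v, 2 ≤ degIn Y.fstEnd Y.sndEnd Finset.univ v := fun v => by
    rw [Y.degIn_univ_eq_degree v]
    exact_mod_cast hY v v.2
  obtain ⟨V₁, E₁, _, _, _, s₁, t₁, n, h₁, φ₁, ψ₁, hi₁⟩ :=
    exists_endsIso_sub_reduced _ X.fstEnd X.sndEnd rfl hdX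
  obtain ⟨V₂, E₂, _, _, _, s₂, t₂, m, h₂, φ₂, ψ₂, hi₂⟩ :=
    exists_endsIso_sub_reduced _ Y.fstEnd Y.sndEnd rfl hdY
  refine nonempty_iso_of_endsIso (EndsIso.trans ⟨φ₁, ψ₁, hi₁⟩ (EndsIso.trans ?_
    (EndsIso.symm ⟨φ₂, ψ₂, hi₂⟩)))
  -- The bijection between pieces of the two subdivisions goes back to the edges of `X`, across by
  -- the arc bijection, and on from the edges of `Y`; each leg preserves defects.
  refine h₁.endsIso_sub h₂ ((ψ₁.symm.trans (edgeEquivOfArcEquiv σ hσ)).trans ψ₂) fun R => ?_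
  have hR : (R.map ψ₁.symm.toEmbedding).map ψ₁.toEmbedding = R := by
    ext x; simp
  have e1 := defect_map hi₁ (R.map ψ₁.symm.toEmbedding)
  rw [hR] at e1
  have e2 := defect_eq_of_edgeZeta_eq X Y σ hσ hζ (R.map ψ₁.symm.toEmbedding)
  have e3 := defect_map hi₂
    ((R.map ψ₁.symm.toEmbedding).map (edgeEquivOfArcEquiv σ hσ).toEmbedding)
  rw [← e1, e2, e3]
  rw [Finset.map_map, Finset.map_map]
  rfl

end Graph

/-- The bijection `σ` says which indeterminate of `ζ_Y` plays the role of which indeterminate of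
`ζ_X`; like the functions themselves, it knows which indeterminates belong to inverse arcs. -/
theorem theorem3p5 {α β α' β' γ δ : Type*}
    (X : Graph α β) [Finite V(X)] [Finite E(X)]
    (Y : Graph α' β') [Finite V(Y)] [Finite E(Y)]
    (W : Graph γ δ) [Finite V(W)] [Finite E(W)]
    (hX : X.MD2) (hY : Y.MD2)
    (k : ℕ) (hk : W.IsRegular k) (hW : W.IsDeterminedBySpectrum)
    (σ : X.Arc ≃ Y.Arc) (hσ : ∀ a : X.Arc, σ a.rev = (σ a).rev)
    (hζ : ∀ᶠ u : Y.Arc → ℂ in nhds 0, X.edgeZeta (fun a => u (σ a)) = Y.edgeZeta u) :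
    W.vertexInducedCount X = W.vertexInducedCount Y ∧
      W.edgeInducedCount X = W.edgeInducedCount Y := by
  obtain ⟨i⟩ := Graph.nonempty_iso_of_edgeZeta_eq X Y hX hY σ hσ hζ
  exact ⟨le_antisymm (i.vertexInducedCount_le W) (i.symm.vertexInducedCount_le W),
    le_antisymm (i.edgeInducedCount_le W) (i.symm.edgeInducedCount_le W)⟩
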